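/- Let $A$ and $B$ be (possibly unbounded) selfadjoint operators on a separable complex Hilbert space $H$ which commute strongly, i.e. every spectral projection of $A$ commutes with every spectral projection of $B$. Let $\Delta = 1+(A+iB)(A-iB)$, with its natural domain, and assume that $\Delta$ has a bounded inverse $\Delta^{-1}$ on $H$ which is compact. Let $C$ be the closure of $A+iB$, defined on $D(A)\cap D(B)$. Then the following hold. (1) $\omega(A,B)=0$, in the following sense. The matrix $$Q=Q(A,B)=\begin{pmatrix}\Delta^{-1} & C\Delta^{-1}\\ \Delta^{-1}C^* & 1-\Delta^{-1}\end{pmatrix}$$ defines a bounded operator on $H\oplus H$ (that is, $C\Delta^{-1}$ is everywhere defined, and there is a bounded $Q$ given by this formula on $D(C^*)\oplus H$), with $\|Q^2-Q\|<1/4$. For every orthonormal basis of $H$ and every sufficiently large finite set $F$ of its vectors (i.e. every finite $F$ containing a certain finite set $F_0$), with $L=\operatorname{span}F$ and $q_{11}$ the compression of $Q$ to $L\oplus L$, one has $\|q_{11}^2-q_{11}\|<1/4$, and $$\omega(A,B):=\#\{\text{eigenvalues of } q_{11} \text{ greater than } 1/2, \text{ with multiplicity}\}-\dim L = 0 .$$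 (2) There are an orthonormal basis $(f_i)_{i\in I}$ of $H$ and real numbers $a_i,b_i$ such that $A$ and $B$ are the (maximal) operators of multiplication by $(a_i)$ and $(b_i)$ in this basis, $a_i^2+b_i^2\to\infty$ (for every real $r$, $a_i^2+b_i^2\le r$ holds only for finitely many $i$), and $Q$ maps each $\mathbb{C}f_i\oplus\mathbb{C}f_i$ into itself, acting there by the matrix $$\begin{pmatrix}\dfrac{1}{1+|z_i|^2} & \dfrac{z_i}{1+|z_i|^2}\\[2mm] \dfrac{\overline{z_i}}{1+|z_i|^2} & 1-\dfrac{1}{1+|z_i|^2}\end{pmatrix},\qquad z_i=a_i+ib_i,$$ which is an orthogonal projection of rank one. -/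

import Mathlib

open Filter Topology MeasureTheory
open scoped ENNReal

/-- A projection-valued measure on the Borel sets of `ℝ`, with values in the orthogonal
projections of the complex Hilbert space `H` (countable additivity in the strong operator
topology). -/
structure ProjValuedMeasure (H : Type*) [NormedAddCommGroup H] [InnerProductSpace ℂ H]
    [CompleteSpace H] where
  proj : Set ℝ → H →L[ℂ] H
  isStarProjection : ∀ S : Set ℝ, MeasurableSet S → IsStarProjection (proj S)
  proj_univ : proj Set.univ = 1
  hasSum_iUnion : ∀ S : ℕ → Set ℝ, (∀ n, MeasurableSet (S n)) →
    Pairwise (Function.onFun Disjoint S) →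
      ∀ x : H, HasSum (fun n => proj (S n) x) (proj (⋃ n, S n) x)

namespace ProjValuedMeasure

variable {H : Type*} [NormedAddCommGroup H] [InnerProductSpace ℂ H] [CompleteSpace H]

theorem norm_sq_proj (E : ProjValuedMeasure H) {S : Set ℝ} (hS : MeasurableSet S) (x : H) :
    ‖E.proj S x‖ ^ 2 = (inner ℂ x (E.proj S x)).re := by
  have h := E.isStarProjection S hS
  have h1 : E.proj S (E.proj S x) = E.proj S x := by
    have := congrArg (fun T : H →L[ℂ] H => T x) h.isIdempotentElem.eq
    simpa using this
  have h2 : inner ℂ (E.proj S x) (E.proj S x) = inner ℂ x (E.proj S (E.proj S x)) := by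
    have h3 := ContinuousLinearMap.adjoint_inner_left (E.proj S) (E.proj S x) x
    rwa [h.isSelfAdjoint.adjoint_eq] at h3
  rw [h1] at h2
  rw [← h2]
  exact (inner_self_eq_norm_sq (𝕜 := ℂ) (E.proj S x)).symm

theorem hasSum_norm_sq (E : ProjValuedMeasure H) {S : ℕ → Set ℝ} (hS : ∀ n, MeasurableSet (S n))
    (hd : Pairwise (Function.onFun Disjoint S)) (x : H) :
    HasSum (fun n => ‖E.proj (S n) x‖ ^ 2) (‖E.proj (⋃ n, S n) x‖ ^ 2) := by
  simp only [E.norm_sq_proj (hS _), E.norm_sq_proj (MeasurableSet.iUnion hS)]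
  exact Complex.hasSum_re ((innerSL ℂ x).hasSum (E.hasSum_iUnion S hS hd x))

theorem proj_empty (E : ProjValuedMeasure H) (x : H) : E.proj ∅ x = 0 := by
  have h := E.hasSum_iUnion (fun _ => ∅) (fun _ => MeasurableSet.empty)
    (fun _ _ _ => by simp [Function.onFun]) x
  have h2 := h.summable.tendsto_atTop_zero
  exact tendsto_nhds_unique tendsto_const_nhds h2

/-- The scalar measure `S ↦ ‖E(S) x‖² = ⟪x, E(S) x⟫` attached to a vector `x`. -/
noncomputable def scalarMeasure (E : ProjValuedMeasure H) (x : H) : Measure ℝ :=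
  Measure.ofMeasurable (fun S _ => ENNReal.ofReal (‖E.proj S x‖ ^ 2))
    (by simp [E.proj_empty])
    (by
      intro S hS hd
      have h := E.hasSum_norm_sq hS hd x
      rw [← h.tsum_eq]
      exact ENNReal.ofReal_tsum_of_nonneg (fun _ => by positivity) h.summable)

/-- `E` is the spectral measure of `A`, i.e. `A = ∫ t dE(t)`: the domain of `A` consists of the
`x` with `∫ t² d⟪x, E(t) x⟫ < ∞`, and `⟪x, A x⟫ = ∫ t d⟪x, E(t) x⟫` there. -/
structure IsSpectralMeasureOf (E : ProjValuedMeasure H) (A : H →ₗ.[ℂ] H) : Prop where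
  mem_domain_iff : ∀ x : H,
    x ∈ A.domain ↔ ∫⁻ t, ENNReal.ofReal (t ^ 2) ∂(E.scalarMeasure x) < ∞
  inner_apply : ∀ x : A.domain,
    inner ℂ (x : H) (A x) = ((∫ t, t ∂(E.scalarMeasure (x : H)) : ℝ) : ℂ)

end ProjValuedMeasure

section Omega

variable {H : Type*} [NormedAddCommGroup H] [InnerProductSpace ℂ H]

/-- Two unbounded selfadjoint operators commute (strongly): all the spectral projections of the
one commute with all the spectral projections of the other. -/
def StronglyCommute [CompleteSpace H] (A B : H →ₗ.[ℂ] H) : Prop :=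
  ∃ E F : ProjValuedMeasure H, E.IsSpectralMeasureOf A ∧ F.IsSpectralMeasureOf B ∧
    ∀ S T : Set ℝ, MeasurableSet S → MeasurableSet T → Commute (E.proj S) (F.proj T)

/-- The composition `S T` of unbounded operators, on its natural domain
`{x ∈ D(T) : T x ∈ D(S)}`. -/
noncomputable def pcomp (S T : H →ₗ.[ℂ] H) : H →ₗ.[ℂ] H :=
  S.comp (T.domRestrict ((S.domain.comap T.toFun).map T.domain.subtype)) (by
    rintro ⟨x, hx, hxT⟩
    obtain ⟨y, hy, rfl⟩ := hx
    exact hy)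

/-- `A + iB`, with domain `D(A) ∩ D(B)`. -/
noncomputable def opPlus (A B : H →ₗ.[ℂ] H) : H →ₗ.[ℂ] H := A + Complex.I • B

/-- `A - iB`, with domain `D(A) ∩ D(B)`. -/
noncomputable def opMinus (A B : H →ₗ.[ℂ] H) : H →ₗ.[ℂ] H := A - Complex.I • B

/-- `Δ = 1 + (A + iB)(A - iB)`. -/
noncomputable def opDelta (A B : H →ₗ.[ℂ] H) : H →ₗ.[ℂ] H :=
  (LinearMap.id : H →ₗ[ℂ] H) +ᵥ pcomp (opPlus A B) (opMinus A B)

/-- The bounded everywhere defined operator `R` is the inverse of the unbounded operator `T`. -/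
def IsBoundedInverse (T : H →ₗ.[ℂ] H) (R : H →L[ℂ] H) : Prop :=
  (∀ y : H, ∃ h : R y ∈ T.domain, T ⟨R y, h⟩ = y) ∧ ∀ x : T.domain, R (T x) = x

/-- `C`, the closure of `A + iB`. -/
noncomputable def opC (A B : H →ₗ.[ℂ] H) : H →ₗ.[ℂ] H := (opPlus A B).closure

/-- The bounded operator `Q` on the Hilbert space `H ⊕ H` is
`Q(A,B) = [[Δ⁻¹, C Δ⁻¹], [Δ⁻¹ C*, 1 - Δ⁻¹]]`. Here `C Δ⁻¹` is everywhere defined, and `Δ⁻¹ C*`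
is defined on the (dense) domain of `C*`, so that the boundedness of `Q` determines it. -/
def IsQ [CompleteSpace H] (A B : H →ₗ.[ℂ] H)
    (Q : WithLp 2 (H × H) →L[ℂ] WithLp 2 (H × H)) : Prop :=
  ∃ R : H →L[ℂ] H, IsBoundedInverse (opDelta A B) R ∧
    ∃ hC : ∀ y : H, R y ∈ (opC A B).domain,
      ∀ (x : (opC A B).adjoint.domain) (y : H),
        Q (WithLp.toLp 2 ((x : H), y)) =
          WithLp.toLp 2 (R x + opC A B ⟨R y, hC y⟩, R ((opC A B).adjoint x) + (y - R y))

/-- For a set `F` of indices of an orthonormal basis `e` with span `L = span {e i | i ∈ F}`, the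
subspace `L ⊕ L` of `H ⊕ H`. -/
def doubleSpan {ι : Type*} (e : HilbertBasis ι ℂ H) (F : Finset ι) :
    Submodule ℂ (WithLp 2 (H × H)) :=
  let L : Submodule ℂ H := Submodule.span ℂ (e '' (F : Set ι))
  (L.prod L).map (WithLp.linearEquiv 2 ℂ (H × H)).symm.toLinearMap

instance finiteDimensional_doubleSpan {ι : Type*} (e : HilbertBasis ι ℂ H) (F : Finset ι) :
    FiniteDimensional ℂ (doubleSpan e F) := by
  have h : (Submodule.span ℂ (e '' (F : Set ι))).FG :=
    Submodule.fg_span (F.finite_toSet.image _)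
  exact Module.Finite.iff_fg.2 ((h.prod h).map _)

/-- The corner `q₁₁` of `Q` in the decomposition of `H ⊕ H` into `L ⊕ L` and its orthogonal
complement, an operator on the finite-dimensional space `L ⊕ L`. -/
noncomputable def corner {ι : Type*} (e : HilbertBasis ι ℂ H) (F : Finset ι)
    (Q : WithLp 2 (H × H) →L[ℂ] WithLp 2 (H × H)) : doubleSpan e F →L[ℂ] doubleSpan e F :=
  (doubleSpan e F).orthogonalProjectionOnto ∘L Q ∘L (doubleSpan e F).subtypeL

/-- The number of eigenvalues `> 1/2` of a selfadjoint operator `q` on a finite-dimensional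
space, counted with multiplicity. -/
noncomputable def countAboveHalf {V : Type*} [NormedAddCommGroup V] [InnerProductSpace ℂ V]
    (q : V →L[ℂ] V) : ℕ :=
  Module.finrank ℂ
    (⨆ (t : ℝ) (_ : 1 / 2 < t), Module.End.eigenspace (q : Module.End ℂ V) (t : ℂ) :
      Submodule ℂ V)

/-- `ω(A,B)` is defined and equal to `k`: `Δ⁻¹` exists and is compact, `Q = Q(A,B)` is a bounded
operator with `‖Q² - Q‖ < 1/4`, and for every orthonormal basis of `H` and all large enough finite
sets `F` of basis vectors, with `q₁₁` the corner of `Q` on `L ⊕ L`, `L = span F`, one has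
`‖q₁₁² - q₁₁‖ < 1/4`, and the number of eigenvalues `> 1/2` of `q₁₁` minus `dim L` is `k`.
(For `ι = ℕ` this contains the case `F = {0, …, N-1}`, `N` large. All orthonormal bases of a
separable space can be indexed by an `ι : Type`.) -/
def HasOmega [CompleteSpace H] (A B : H →ₗ.[ℂ] H) (k : ℤ) : Prop :=
  (∃ R : H →L[ℂ] H, IsBoundedInverse (opDelta A B) R ∧ IsCompactOperator R) ∧
  ∃ Q : WithLp 2 (H × H) →L[ℂ] WithLp 2 (H × H), IsQ A B Q ∧ ‖Q * Q - Q‖ < 1 / 4 ∧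
    ∀ (ι : Type) (e : HilbertBasis ι ℂ H), ∀ᶠ F : Finset ι in atTop,
      ‖corner e F Q * corner e F Q - corner e F Q‖ < 1 / 4 ∧
        (countAboveHalf (corner e F Q) : ℤ) - (F.card : ℤ) = k

/-- In the orthonormal basis `f`, the unbounded operator `A` is the (maximal) operator of
multiplication by the real function `a`. -/
def IsMultiplication {ι : Type*} (f : HilbertBasis ι ℂ H) (a : ι → ℝ) (A : H →ₗ.[ℂ] H) : Prop :=
  (∀ x : H, x ∈ A.domain ↔ Summable fun i => ‖(a i : ℂ) * f.repr x i‖ ^ 2) ∧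
    ∀ (x : A.domain) (i : ι), f.repr (A x) i = (a i : ℂ) * f.repr (x : H) i

/-- The Bott projection `P(x,y)`, at `z = x + iy`. -/
noncomputable def bott (z : ℂ) : Matrix (Fin 2) (Fin 2) ℂ :=
  !![1 / (1 + (‖z‖ : ℂ) ^ 2), z / (1 + (‖z‖ : ℂ) ^ 2);
     (starRingEnd ℂ) z / (1 + (‖z‖ : ℂ) ^ 2), 1 - 1 / (1 + (‖z‖ : ℂ) ^ 2)]

end Omega

/-! ### Spectral measures: additivity, commutation, vanishing cross terms -/

namespace ProjValuedMeasure

variable {H : Type*} [NormedAddCommGroup H] [InnerProductSpace ℂ H] [CompleteSpace H]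

/-! Strong commutation and compactness of `R = Δ⁻¹` give an orthonormal basis `f` of joint
eigenvectors of `A` and `B`. The eigenspaces of `R` for nonzero eigenvalues are finite-dimensional
and preserved by all spectral projections, so `A` and `B` can be diagonalised inside them
(`orthogonal_iSup_jointEigenspace`, `exists_hilbertBasis_jointEigenvector`). Compactness of `R` then
says `1 / (1 + |z i|²) → 0`, where `z i` is the joint eigenvalue.

In this basis `Q` is block diagonal with the Bott projections at the `z i` as blocks
(`isQ_of_isBlockDiagonal`). It is therefore a projection, and a compact perturbation of `0 ⊕ 1`.

To count eigenvalues, each Bott projection is conjugated to `diag(0, 1)` by a unitary `bottRotation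
(z i)` tending to the identity as `|z i| → ∞`. The phase `exp (i arg z)` in it is discontinuous, and
on the whole plane no continuous choice exists, because the Bott bundle is nontrivial; over a
discrete joint spectrum continuity is irrelevant, and this is why `ω` vanishes. The result is an
isometry `U`, equal to `1` plus a compact operator, with `Q U = U (0 ⊕ 1)`. When `L` is large, `Q`
and `U` almost preserve `L ⊕ L` (`IsBlockDiagonal.eventually_approx`). Hence `q₁₁` is almost
idempotent, and compressing `U (L ⊕ 0)` and `U (0 ⊕ L)` to `L ⊕ L` gives two subspaces of dimension
`dim L` on which the form of `q₁₁` is below, respectively above, one half. The min-max argument of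
`countAboveHalf_eq` then leaves exactly `dim L` eigenvalues above `1/2`. -/

theorem scalarMeasure_apply (E : ProjValuedMeasure H) (x : H) {S : Set ℝ} (hS : MeasurableSet S) :
    E.scalarMeasure x S = ENNReal.ofReal (‖E.proj S x‖ ^ 2) := by
  rw [scalarMeasure, Measure.ofMeasurable_apply S hS]

instance isFiniteMeasure_scalarMeasure (E : ProjValuedMeasure H) (x : H) :
    IsFiniteMeasure (E.scalarMeasure x) :=
  ⟨by rw [E.scalarMeasure_apply x MeasurableSet.univ]; exact ENNReal.ofReal_lt_top⟩

theorem scalarMeasure_add (E : ProjValuedMeasure H) {u v : H}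
    (h : ∀ S, MeasurableSet S → inner ℂ (E.proj S u) (E.proj S v) = 0) :
    E.scalarMeasure (u + v) = E.scalarMeasure u + E.scalarMeasure v := by
  ext S hS
  rw [Measure.add_apply, E.scalarMeasure_apply _ hS, E.scalarMeasure_apply _ hS,
    E.scalarMeasure_apply _ hS, ← ENNReal.ofReal_add (by positivity) (by positivity), map_add]
  congr 1
  have := norm_add_sq_eq_norm_sq_add_norm_sq_of_inner_eq_zero _ _ (h S hS)
  nlinarith

theorem proj_union (E : ProjValuedMeasure H) {S T : Set ℝ} (hS : MeasurableSet S)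
    (hT : MeasurableSet T) (hd : Disjoint S T) : E.proj (S ∪ T) = E.proj S + E.proj T := by
  -- Finite additivity is countable additivity with the sequence padded by empty sets.
  let s : ℕ → Set ℝ := fun n => if n = 0 then S else if n = 1 then T else ∅
  have hs : ∀ n, MeasurableSet (s n) := fun n => by
    dsimp only [s]; split_ifs <;> first | assumption | exact MeasurableSet.empty
  have hsd : Pairwise (Function.onFun Disjoint s) := fun m n hmn => by
    dsimp only [Function.onFun, s]
    split_ifs with h1 h2 h3 h4 <;> first | omega | exact hd | exact hd.symm | simp
  have hu : ⋃ n, s n = S ∪ T := by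
    ext t
    simp only [Set.mem_iUnion, Set.mem_union]
    constructor
    · rintro ⟨n, hn⟩
      dsimp only [s] at hn
      split_ifs at hn
      · exact Or.inl hn
      · exact Or.inr hn
      · exact hn.elim
    · rintro (h | h)
      · exact ⟨0, by simpa [s] using h⟩
      · exact ⟨1, by simpa [s] using h⟩
  ext x
  have h1 := E.hasSum_iUnion s hs hsd x
  have h2 : HasSum (fun n => E.proj (s n) x) (∑ n ∈ {0, 1}, E.proj (s n) x) :=
    hasSum_sum_of_ne_finset_zero fun n hn => by
      have h0 : n ≠ 0 ∧ n ≠ 1 := by simpa using hn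
      simp only [s, h0.1, h0.2, if_false, E.proj_empty]
  rw [hu] at h1
  rw [h1.unique h2]
  simp [s]

/-- The sum `p + q` is again idempotent, so `pq + qp = 0`; multiplying by `p` on the left and on the
right gives `pq = -pqp = qp`. -/
theorem commute_proj_of_disjoint (E : ProjValuedMeasure H) {S T : Set ℝ} (hS : MeasurableSet S)
    (hT : MeasurableSet T) (hd : Disjoint S T) : Commute (E.proj S) (E.proj T) := by
  have hp := (E.isStarProjection S hS).isIdempotentElem.eq
  have hq := (E.isStarProjection T hT).isIdempotentElem.eq
  have hr := (E.isStarProjection _ (hS.union hT)).isIdempotentElem.eq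
  rw [E.proj_union hS hT hd] at hr
  generalize E.proj S = p at *
  generalize E.proj T = q at *
  have h0 : p * q + q * p = 0 := by
    have : (p + q) * (p + q) = p * p + q * q + (p * q + q * p) := by noncomm_ring
    rw [this, hp, hq] at hr
    simpa using hr
  have h1 : p * q + p * q * p = 0 := by
    have : p * (p * q + q * p) = p * p * q + p * q * p := by noncomm_ring
    rwa [h0, hp, mul_zero, eq_comm] at this
  have h2 : p * q * p + q * p = 0 := by
    have : (p * q + q * p) * p = p * q * p + q * (p * p) := by noncomm_ring
    rwa [h0, hp, zero_mul, eq_comm] at this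
  exact (eq_neg_of_add_eq_zero_left h1).trans (eq_neg_of_add_eq_zero_right h2).symm

/-- Strong commutation only relates the projections of `A` to those of `B`. This supplies the
remaining commutations, needed for the projections of `A` to reduce `A` itself. Both sets are cut
along `S ∩ T`. -/
theorem commute_proj (E : ProjValuedMeasure H) {S T : Set ℝ} (hS : MeasurableSet S)
    (hT : MeasurableSet T) : Commute (E.proj S) (E.proj T) := by
  have h1 := E.proj_union (hS.inter hT) (hS.diff hT)
    (Set.disjoint_sdiff_right.mono_left Set.inter_subset_right)
  have h2 := E.proj_union (hT.inter hS) (hT.diff hS)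
    (Set.disjoint_sdiff_right.mono_left Set.inter_subset_right)
  rw [Set.inter_union_sdiff] at h1 h2
  rw [h1, h2, Set.inter_comm T S]
  refine .add_left (.add_right (.refl _) ?_) (.add_right ?_ ?_)
  · exact E.commute_proj_of_disjoint (hS.inter hT) (hT.diff hS)
      (Set.disjoint_sdiff_right.mono_left Set.inter_subset_left)
  · exact E.commute_proj_of_disjoint (hS.diff hT) (hS.inter hT)
      (Set.disjoint_sdiff_left.mono_right Set.inter_subset_right)
  · exact E.commute_proj_of_disjoint (hS.diff hT) (hT.diff hS)
      (Set.disjoint_sdiff_left.mono_right Set.sdiff_subset)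

theorem IsSpectralMeasureOf.integrable {E : ProjValuedMeasure H} {A : H →ₗ.[ℂ] H}
    (hE : E.IsSpectralMeasureOf A) (x : A.domain) :
    Integrable (fun t : ℝ => t) (E.scalarMeasure (x : H)) := by
  have h2 : MemLp (fun t : ℝ => t) 2 (E.scalarMeasure (x : H)) := by
    rw [memLp_two_iff_integrable_sq (by fun_prop)]
    refine ⟨by fun_prop, ?_⟩
    rw [hasFiniteIntegral_iff_ofReal (Eventually.of_forall fun t => sq_nonneg t)]
    exact (hE.mem_domain_iff x).1 x.2
  exact h2.integrable (by norm_num)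

theorem IsSpectralMeasureOf.inner_apply_add_inner_apply {E : ProjValuedMeasure H} {A : H →ₗ.[ℂ] H}
    (hE : E.IsSpectralMeasureOf A) (u v : A.domain)
    (h : ∀ S, MeasurableSet S → inner ℂ (E.proj S (u : H)) (E.proj S (v : H)) = 0) :
    inner ℂ (u : H) (A v) + inner ℂ (v : H) (A u) = 0 := by
  have h1 := hE.inner_apply (u + v)
  rw [Submodule.coe_add, E.scalarMeasure_add h,
    integral_add_measure (hE.integrable u) (hE.integrable v), Complex.ofReal_add,
    ← hE.inner_apply u, ← hE.inner_apply v, A.map_add, inner_add_left, inner_add_right,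
    inner_add_right] at h1
  linear_combination h1

/-- The spectral measure prescribes only the diagonal values `⟪x, A x⟫`, so this is a polarisation:
additivity of the scalar measures kills the symmetric sum of cross terms, and replacing `v` by `i v`
kills their difference. -/
theorem IsSpectralMeasureOf.inner_apply_eq_zero {E : ProjValuedMeasure H} {A : H →ₗ.[ℂ] H}
    (hE : E.IsSpectralMeasureOf A) (u v : A.domain)
    (h : ∀ S, MeasurableSet S → inner ℂ (E.proj S (u : H)) (E.proj S (v : H)) = 0) :
    inner ℂ (u : H) (A v) = 0 := by
  have h1 := hE.inner_apply_add_inner_apply u v h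
  have h2 := hE.inner_apply_add_inner_apply u (Complex.I • v) fun S hS => by
    rw [Submodule.coe_smul, map_smul, inner_smul_right, h S hS, mul_zero]
  rw [A.map_smul, Submodule.coe_smul, inner_smul_right, inner_smul_left, Complex.conj_I] at h2
  have h3 : Complex.I * (inner ℂ (u : H) (A v) - inner ℂ (v : H) (A u)) = 0 := by
    linear_combination h2
  have h4 := (mul_eq_zero.1 h3).resolve_left Complex.I_ne_zero
  linear_combination (h1 + h4) / 2

end ProjValuedMeasure

/-! ### Bounded operators commuting with unbounded ones; symmetry of `Δ⁻¹` -/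

section Reduction

variable {H : Type*} [NormedAddCommGroup H] [InnerProductSpace ℂ H]

/-- The bounded operator `T` commutes with the unbounded operator `A`, i.e. `T A ⊆ A T`. -/
def Reduces (T : H →L[ℂ] H) (A : H →ₗ.[ℂ] H) : Prop :=
  ∀ x y : H, (x, y) ∈ A.graph → (T x, T y) ∈ A.graph

theorem mem_graph_opPlus_iff {A B : H →ₗ.[ℂ] H} {x y : H} :
    (x, y) ∈ (opPlus A B).graph ↔
      ∃ a b, (x, a) ∈ A.graph ∧ (x, b) ∈ B.graph ∧ y = a + Complex.I • b := by
  constructor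
  · intro h
    obtain ⟨u, rfl, rfl⟩ := (LinearPMap.mem_graph_iff _).1 h
    exact ⟨_, _, A.mem_graph ⟨u, u.2.1⟩, B.mem_graph ⟨u, u.2.2⟩, rfl⟩
  · rintro ⟨a, b, ha, hb, rfl⟩
    obtain ⟨u, rfl, rfl⟩ := (LinearPMap.mem_graph_iff A).1 ha
    obtain ⟨⟨v, hv⟩, rfl : v = _, h2⟩ := (LinearPMap.mem_graph_iff B).1 hb
    exact (LinearPMap.mem_graph_iff _).2 ⟨⟨u, u.2, hv⟩, rfl,
      congrArg (fun w => A u + Complex.I • w) h2⟩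

theorem mem_graph_opMinus_iff {A B : H →ₗ.[ℂ] H} {x y : H} :
    (x, y) ∈ (opMinus A B).graph ↔
      ∃ a b, (x, a) ∈ A.graph ∧ (x, b) ∈ B.graph ∧ y = a - Complex.I • b := by
  constructor
  · intro h
    obtain ⟨u, rfl, rfl⟩ := (LinearPMap.mem_graph_iff _).1 h
    exact ⟨_, _, A.mem_graph ⟨u, u.2.1⟩, B.mem_graph ⟨u, u.2.2⟩, rfl⟩
  · rintro ⟨a, b, ha, hb, rfl⟩
    obtain ⟨u, rfl, rfl⟩ := (LinearPMap.mem_graph_iff A).1 ha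
    obtain ⟨⟨v, hv⟩, rfl : v = _, h2⟩ := (LinearPMap.mem_graph_iff B).1 hb
    exact (LinearPMap.mem_graph_iff _).2 ⟨⟨u, u.2, hv⟩, rfl,
      congrArg (fun w => A u - Complex.I • w) h2⟩

theorem mem_graph_pcomp_iff {S T : H →ₗ.[ℂ] H} {x z : H} :
    (x, z) ∈ (pcomp S T).graph ↔ ∃ y, (x, y) ∈ T.graph ∧ (y, z) ∈ S.graph := by
  constructor
  · intro h
    obtain ⟨u, rfl, rfl⟩ := (LinearPMap.mem_graph_iff _).1 h
    exact ⟨_, T.mem_graph ⟨u, u.2.2⟩, S.mem_graph ⟨T ⟨u, u.2.2⟩, _⟩⟩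
  · rintro ⟨y, hy, hz⟩
    obtain ⟨u, rfl, rfl⟩ := (LinearPMap.mem_graph_iff T).1 hy
    obtain ⟨⟨v, hv⟩, rfl : v = _, h2⟩ := (LinearPMap.mem_graph_iff S).1 hz
    exact (LinearPMap.mem_graph_iff _).2 ⟨⟨u, ⟨u, hv, rfl⟩, u.2⟩, rfl, h2⟩

theorem mem_graph_opDelta_iff {A B : H →ₗ.[ℂ] H} {x w : H} :
    (x, w) ∈ (opDelta A B).graph ↔
      ∃ y z, (x, y) ∈ (opMinus A B).graph ∧ (y, z) ∈ (opPlus A B).graph ∧ w = x + z := by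
  have h0 : (x, w) ∈ (opDelta A B).graph ↔
      ∃ z, (x, z) ∈ (pcomp (opPlus A B) (opMinus A B)).graph ∧ w = x + z := by
    constructor
    · intro h
      obtain ⟨u, rfl, rfl⟩ := (LinearPMap.mem_graph_iff _).1 h
      exact ⟨_, LinearPMap.mem_graph (pcomp (opPlus A B) (opMinus A B)) u, rfl⟩
    · rintro ⟨z, hz, rfl⟩
      obtain ⟨u, rfl, rfl⟩ := (LinearPMap.mem_graph_iff _).1 hz
      exact (LinearPMap.mem_graph_iff _).2 ⟨u, rfl, rfl⟩
  rw [h0]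
  constructor
  · rintro ⟨z, hz, rfl⟩
    obtain ⟨y, hy, hz⟩ := mem_graph_pcomp_iff.1 hz
    exact ⟨y, z, hy, hz, rfl⟩
  · rintro ⟨y, z, hy, hz, rfl⟩
    exact ⟨z, mem_graph_pcomp_iff.2 ⟨y, hy, hz⟩, rfl⟩

theorem Reduces.opPlus {T : H →L[ℂ] H} {A B : H →ₗ.[ℂ] H} (hA : Reduces T A) (hB : Reduces T B) :
    Reduces T (opPlus A B) := by
  intro x y h
  obtain ⟨a, b, ha, hb, rfl⟩ := mem_graph_opPlus_iff.1 h
  exact mem_graph_opPlus_iff.2 ⟨_, _, hA _ _ ha, hB _ _ hb, by simp⟩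

theorem Reduces.opMinus {T : H →L[ℂ] H} {A B : H →ₗ.[ℂ] H} (hA : Reduces T A) (hB : Reduces T B) :
    Reduces T (opMinus A B) := by
  intro x y h
  obtain ⟨a, b, ha, hb, rfl⟩ := mem_graph_opMinus_iff.1 h
  exact mem_graph_opMinus_iff.2 ⟨_, _, hA _ _ ha, hB _ _ hb, by simp⟩

theorem Reduces.opDelta {T : H →L[ℂ] H} {A B : H →ₗ.[ℂ] H} (hA : Reduces T A) (hB : Reduces T B) :
    Reduces T (opDelta A B) := by
  intro x w h
  obtain ⟨y, z, hy, hz, rfl⟩ := mem_graph_opDelta_iff.1 h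
  exact mem_graph_opDelta_iff.2 ⟨_, _, hA.opMinus hB _ _ hy, hA.opPlus hB _ _ hz, by simp⟩

theorem IsBoundedInverse.mem_graph {T : H →ₗ.[ℂ] H} {R : H →L[ℂ] H} (h : IsBoundedInverse T R)
    (y : H) : (R y, y) ∈ T.graph := by
  obtain ⟨h1, h2⟩ := h.1 y
  exact (LinearPMap.mem_graph_iff _).2 ⟨⟨R y, h1⟩, rfl, h2⟩

theorem IsBoundedInverse.apply_of_mem_graph {T : H →ₗ.[ℂ] H} {R : H →L[ℂ] H}
    (h : IsBoundedInverse T R) {x y : H} (hxy : (x, y) ∈ T.graph) : R y = x := by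
  obtain ⟨u, rfl, rfl⟩ := (LinearPMap.mem_graph_iff _).1 hxy
  exact h.2 u

theorem IsBoundedInverse.unique {T : H →ₗ.[ℂ] H} {R R' : H →L[ℂ] H}
    (h : IsBoundedInverse T R) (h' : IsBoundedInverse T R') : R = R' := by
  ext y
  exact (h'.apply_of_mem_graph (h.mem_graph y)).symm

theorem IsBoundedInverse.injective {T : H →ₗ.[ℂ] H} {R : H →L[ℂ] H}
    (h : IsBoundedInverse T R) {y : H} (hy : R y = 0) : y = 0 := by
  have h1 := h.mem_graph y
  rw [hy] at h1
  exact T.graph_fst_eq_zero_snd h1 rfl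

theorem IsBoundedInverse.comm_of_reduces {D : H →ₗ.[ℂ] H} {R T : H →L[ℂ] H}
    (h : IsBoundedInverse D R) (hT : Reduces T D) (y : H) : R (T y) = T (R y) :=
  h.apply_of_mem_graph (hT _ _ (h.mem_graph y))

variable [CompleteSpace H]

theorem IsStarProjection.inner_apply_sub {T : H →L[ℂ] H} (hT : IsStarProjection T) (x y : H) :
    inner ℂ (T x) (y - T y) = 0 := by
  have h3 := ContinuousLinearMap.adjoint_inner_left T (y - T y) x
  rw [hT.isSelfAdjoint.adjoint_eq] at h3
  have h1 : T (T y) = T y := by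
    have := congrArg (fun T : H →L[ℂ] H => T y) hT.isIdempotentElem.eq
    simpa using this
  rw [h3, map_sub, h1, sub_self, inner_zero_right]

/-- The ranges of `T` and `1 - T` are orthogonal and stay so under every `E(S)`, so `A` has no
matrix entries between them. Testing `A T x` against `T v` and `v - T v` then gives `A T x = T A x`.
-/
theorem ProjValuedMeasure.IsSpectralMeasureOf.reduces {E : ProjValuedMeasure H} {A : H →ₗ.[ℂ] H}
    (hE : E.IsSpectralMeasureOf A) (hA : Dense (A.domain : Set H)) {T : H →L[ℂ] H}
    (hT : IsStarProjection T) (hc : ∀ S, MeasurableSet S → Commute (E.proj S) T) :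
    Reduces T A := by
  have hc' : ∀ S, MeasurableSet S → ∀ x, E.proj S (T x) = T (E.proj S x) := fun S hS x => by
    simpa using congrArg (fun T : H →L[ℂ] H => T x) (hc S hS).eq
  have orth : ∀ x y : H, ∀ S, MeasurableSet S →
      inner ℂ (E.proj S (T x)) (E.proj S (y - T y)) = 0 := fun x y S hS => by
    rw [map_sub, hc' S hS, hc' S hS]
    exact hT.inner_apply_sub _ _
  have dom : ∀ x ∈ A.domain, T x ∈ A.domain := fun x hx => by
    rw [hE.mem_domain_iff] at hx ⊢
    refine lt_of_le_of_lt (lintegral_mono' ?_ le_rfl) hx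
    -- The scalar measure of `x` splits as that of `T x` plus that of `x - T x`, so it dominates the
    -- former.
    conv_rhs => rw [← add_sub_cancel (T x) x]
    rw [E.scalarMeasure_add (orth x x)]
    exact Measure.le_add_right le_rfl
  intro x y hxy
  obtain ⟨x', rfl, rfl⟩ := (LinearPMap.mem_graph_iff A).1 hxy
  rw [LinearPMap.mem_graph_iff]
  refine ⟨⟨T x', dom _ x'.2⟩, rfl, ?_⟩
  refine hA.eq_of_inner_right ℂ fun v hv => ?_
  have h1 := hE.inner_apply_eq_zero ⟨v - T v, A.domain.sub_mem hv (dom v hv)⟩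
    ⟨T x', dom _ x'.2⟩ fun S hS => by rw [← inner_conj_symm, orth x' v S hS, map_zero]
  have h2 := hE.inner_apply_eq_zero ⟨T v, dom v hv⟩ (x' - ⟨T x', dom _ x'.2⟩) (orth v x')
  have h3 := ContinuousLinearMap.adjoint_inner_left T (A x') v
  rw [hT.isSelfAdjoint.adjoint_eq] at h3
  rw [inner_sub_left] at h1
  rw [A.map_sub, inner_sub_right] at h2
  rw [← h3]
  linear_combination h1 - h2

theorem LinearPMap.inner_graph_of_isSelfAdjoint {A : H →ₗ.[ℂ] H} (hA : IsSelfAdjoint A)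
    {x a y b : H} (hx : (x, a) ∈ A.graph) (hy : (y, b) ∈ A.graph) :
    inner ℂ a y = inner ℂ x b := by
  have h := LinearPMap.adjoint_isFormalAdjoint hA.dense_domain
  rw [LinearPMap.isSelfAdjoint_def.1 hA] at h
  obtain ⟨u, rfl, rfl⟩ := (LinearPMap.mem_graph_iff _).1 hx
  obtain ⟨v, rfl, rfl⟩ := (LinearPMap.mem_graph_iff _).1 hy
  exact h u v

theorem inner_opPlus_opMinus {A B : H →ₗ.[ℂ] H} (hA : IsSelfAdjoint A) (hB : IsSelfAdjoint B)
    {x u y v : H} (hx : (x, u) ∈ (opPlus A B).graph) (hy : (y, v) ∈ (opMinus A B).graph) :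
    inner ℂ u y = inner ℂ x v := by
  obtain ⟨a, b, ha, hb, rfl⟩ := mem_graph_opPlus_iff.1 hx
  obtain ⟨c, d, hc, hd, rfl⟩ := mem_graph_opMinus_iff.1 hy
  rw [inner_add_left, inner_smul_left, inner_sub_right, inner_smul_right,
    LinearPMap.inner_graph_of_isSelfAdjoint hA ha hc,
    LinearPMap.inner_graph_of_isSelfAdjoint hB hb hd, Complex.conj_I]
  ring

/-- `A + iB` and `A - iB` are formal adjoints of each other, which makes `Δ`, and hence its inverse,
symmetric. -/
theorem isSymmetric_of_isBoundedInverse_opDelta {A B : H →ₗ.[ℂ] H} (hA : IsSelfAdjoint A)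
    (hB : IsSelfAdjoint B) {R : H →L[ℂ] H} (hR : IsBoundedInverse (opDelta A B) R) :
    (R : H →ₗ[ℂ] H).IsSymmetric := by
  intro x y
  obtain ⟨p, q, hp, hq, hx⟩ := mem_graph_opDelta_iff.1 (hR.mem_graph x)
  obtain ⟨r, s, hr, hs, hy⟩ := mem_graph_opDelta_iff.1 (hR.mem_graph y)
  have h1 := inner_opPlus_opMinus hA hB hq hr
  have h2 := inner_opPlus_opMinus hA hB hs hp
  have h3 : inner ℂ (R x) s = inner ℂ p r := by
    rw [← inner_conj_symm, h2, inner_conj_symm]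
  change inner ℂ (R x) y = inner ℂ x (R y)
  calc inner ℂ (R x) y = inner ℂ (R x) (R y + s) := by rw [← hy]
    _ = inner ℂ (R x + q) (R y) := by rw [inner_add_right, inner_add_left, h1, h3]
    _ = inner ℂ x (R y) := by rw [← hx]

theorem Submodule.starProjection_comm_of_isSelfAdjoint {V : Submodule ℂ H}
    [V.HasOrthogonalProjection] {P : H →L[ℂ] H} (hP : IsSelfAdjoint P) (hV : ∀ x ∈ V, P x ∈ V) :
    Commute P V.starProjection := by
  ext x
  change P (V.starProjection x) = V.starProjection (P x)
  refine (Submodule.eq_starProjection_of_mem_of_inner_eq_zero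
    (hV _ (V.starProjection_apply_mem x)) fun w hw => ?_).symm
  have h3 := ContinuousLinearMap.adjoint_inner_left P w (x - V.starProjection x)
  rw [hP.adjoint_eq] at h3
  rw [← map_sub, h3]
  exact V.starProjection_inner_eq_zero x _ (hV w hw)

end Reduction

/-! ### Joint eigenspaces and the basis of joint eigenvectors -/

section JointEigenspace

variable {H : Type*} [NormedAddCommGroup H] [InnerProductSpace ℂ H]

/-- The eigenspace of the unbounded operator `A` for the real number `t`. -/
def LinearPMap.realEigenspace (A : H →ₗ.[ℂ] H) (t : ℝ) : Submodule ℂ H where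
  carrier := {x | (x, (t : ℂ) • x) ∈ A.graph}
  add_mem' {x y} hx hy := by simpa using A.graph.add_mem hx hy
  zero_mem' := by
    change ((0 : H), (t : ℂ) • (0 : H)) ∈ A.graph
    rw [smul_zero]
    exact A.graph.zero_mem
  smul_mem' c x hx := by
    have := A.graph.smul_mem c hx
    rwa [Prod.smul_mk, smul_comm] at this

/-- The joint eigenspace of `A` and `B` for the pair `p` of real numbers. -/
def jointEigenspace (A B : H →ₗ.[ℂ] H) (p : ℝ × ℝ) : Submodule ℂ H :=
  A.realEigenspace p.1 ⊓ B.realEigenspace p.2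

theorem Reduces.apply_mem_realEigenspace {T : H →L[ℂ] H} {A : H →ₗ.[ℂ] H} (hT : Reduces T A)
    {t : ℝ} {x : H} (hx : x ∈ A.realEigenspace t) : T x ∈ A.realEigenspace t := by
  have := hT _ _ hx
  rwa [map_smul] at this

theorem LinearPMap.smul_mem_graph {A : H →ₗ.[ℂ] H} {x y : H} (c : ℂ) (h : (x, y) ∈ A.graph) :
    (c • x, c • y) ∈ A.graph :=
  A.graph.smul_mem c h

theorem mem_graph_opDelta_of_mem_jointEigenspace {A B : H →ₗ.[ℂ] H} {p : ℝ × ℝ} {x : H}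
    (hx : x ∈ jointEigenspace A B p) :
    (x, (1 + (p.1 : ℂ) ^ 2 + (p.2 : ℂ) ^ 2) • x) ∈ (opDelta A B).graph := by
  obtain ⟨h1, h2⟩ := hx
  refine mem_graph_opDelta_iff.2 ⟨_, _, mem_graph_opMinus_iff.2 ⟨_, _, h1, h2, rfl⟩,
    mem_graph_opPlus_iff.2 ⟨((p.1 : ℂ) - Complex.I * p.2) • (p.1 : ℂ) • x,
      ((p.1 : ℂ) - Complex.I * p.2) • (p.2 : ℂ) • x, ?_, ?_, rfl⟩, ?_⟩
  · rw [smul_smul Complex.I, ← sub_smul]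
    exact LinearPMap.smul_mem_graph _ h1
  · rw [smul_smul Complex.I, ← sub_smul]
    exact LinearPMap.smul_mem_graph _ h2
  · simp only [smul_smul, ← add_smul]
    nth_rewrite 2 [← one_smul ℂ x]
    rw [← add_smul]
    congr 1
    linear_combination ((p.2 : ℂ) ^ 2) * Complex.I_sq

theorem one_add_sq_add_sq_ne_zero (a b : ℝ) : (1 + (a : ℂ) ^ 2 + (b : ℂ) ^ 2) ≠ 0 := by
  have : (1 + a ^ 2 + b ^ 2 : ℝ) ≠ 0 := by positivity
  exact_mod_cast this

theorem apply_of_mem_jointEigenspace {A B : H →ₗ.[ℂ] H} {R : H →L[ℂ] H}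
    (hR : IsBoundedInverse (opDelta A B) R) {p : ℝ × ℝ} {x : H}
    (hx : x ∈ jointEigenspace A B p) : R x = (1 + (p.1 : ℂ) ^ 2 + (p.2 : ℂ) ^ 2)⁻¹ • x := by
  have h := LinearPMap.smul_mem_graph (1 + (p.1 : ℂ) ^ 2 + (p.2 : ℂ) ^ 2)⁻¹
    (mem_graph_opDelta_of_mem_jointEigenspace hx)
  rw [inv_smul_smul₀ (one_add_sq_add_sq_ne_zero _ _)] at h
  exact hR.apply_of_mem_graph h

theorem Reduces.mem_of_starProjection {V : Submodule ℂ H} [V.HasOrthogonalProjection]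
    {A : H →ₗ.[ℂ] H} (h : Reduces V.starProjection A) {x y : H} (hx : x ∈ V)
    (hxy : (x, y) ∈ A.graph) : y ∈ V := by
  have h1 := h _ _ hxy
  rw [Submodule.starProjection_eq_self_iff.2 hx] at h1
  rw [A.mem_graph_snd_inj hxy h1 rfl]
  exact V.starProjection_apply_mem y

variable [CompleteSpace H]

theorem LinearPMap.exists_realEigenvector {A : H →ₗ.[ℂ] H} (hA : IsSelfAdjoint A)
    {V : Submodule ℂ H} [FiniteDimensional ℂ V] (hV : V ≠ ⊥) (hVA : V ≤ A.domain)
    (hinv : ∀ x ∈ V, ∀ y, (x, y) ∈ A.graph → y ∈ V) :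
    ∃ t : ℝ, V ⊓ A.realEigenspace t ≠ ⊥ := by
  let T : V →ₗ[ℂ] V := LinearMap.codRestrict V (A.toFun ∘ₗ Submodule.inclusion hVA) fun x =>
    hinv x x.2 _ (A.mem_graph (Submodule.inclusion hVA x))
  have hT : ∀ x : V, ((x : H), (T x : H)) ∈ A.graph := fun x =>
    A.mem_graph (Submodule.inclusion hVA x)
  have : Nontrivial V := Submodule.nontrivial_iff_ne_bot.2 hV
  obtain ⟨μ, hμ⟩ := Module.End.exists_eigenvalue T
  obtain ⟨x, hx⟩ := hμ.exists_hasEigenvector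
  have hx0 : (x : H) ≠ 0 := fun h => hx.2 (Subtype.ext h)
  have h1 : ((x : H), μ • (x : H)) ∈ A.graph := by
    have := hT x
    rwa [hx.apply_eq_smul] at this
  have h2 := LinearPMap.inner_graph_of_isSelfAdjoint hA h1 h1
  rw [inner_smul_left, inner_smul_right] at h2
  have h3 := mul_right_cancel₀ (inner_self_ne_zero.2 hx0) h2
  obtain ⟨t, rfl⟩ := Complex.conj_eq_iff_real.1 h3
  exact ⟨t, (Submodule.ne_bot_iff _).2 ⟨x, ⟨x.2, h1⟩, hx0⟩⟩

/-- The projection onto `V` commutes with the projections of `A`, so it reduces `A` and `A` maps `V`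
into itself. An eigenspace of `A` in `V` is invariant under the projections of `B`, so the same
argument applies to `B` there. -/
theorem exists_jointEigenvector {A B : H →ₗ.[ℂ] H} (hA : IsSelfAdjoint A) (hB : IsSelfAdjoint B)
    {E F : ProjValuedMeasure H} (hE : E.IsSpectralMeasureOf A) (hF : F.IsSpectralMeasureOf B)
    (hEF : ∀ S T : Set ℝ, MeasurableSet S → MeasurableSet T → Commute (E.proj S) (F.proj T))
    {V : Submodule ℂ H} [FiniteDimensional ℂ V] (hV : V ≠ ⊥) (hVA : V ≤ A.domain)
    (hVB : V ≤ B.domain) (hVE : ∀ S, MeasurableSet S → ∀ x ∈ V, E.proj S x ∈ V)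
    (hVF : ∀ S, MeasurableSet S → ∀ x ∈ V, F.proj S x ∈ V) :
    ∃ p, V ⊓ jointEigenspace A B p ≠ ⊥ := by
  have hV1 : Reduces V.starProjection A := hE.reduces hA.dense_domain
    isStarProjection_starProjection fun S hS =>
      Submodule.starProjection_comm_of_isSelfAdjoint (E.isStarProjection S hS).isSelfAdjoint
        (hVE S hS)
  obtain ⟨a, ha⟩ := LinearPMap.exists_realEigenvector hA hV hVA fun x hx y hxy =>
    hV1.mem_of_starProjection hx hxy
  have hV2 : Reduces (V ⊓ A.realEigenspace a).starProjection B := hF.reduces hB.dense_domain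
    isStarProjection_starProjection fun S hS =>
      Submodule.starProjection_comm_of_isSelfAdjoint (F.isStarProjection S hS).isSelfAdjoint
        fun x hx => ⟨hVF S hS x hx.1, (hE.reduces hA.dense_domain (F.isStarProjection S hS)
          fun T hT => hEF T S hT hS).apply_mem_realEigenspace hx.2⟩
  obtain ⟨b, hb⟩ := LinearPMap.exists_realEigenvector hB ha (inf_le_left.trans hVB)
    fun x hx y hxy => hV2.mem_of_starProjection hx hxy
  exact ⟨(a, b), by rwa [inf_assoc] at hb⟩

/-- The complement `U` is invariant under `R` and all spectral projections. If it were nonzero, the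
compact symmetric `R` would have an eigenspace in `U`, and that would contain a joint eigenvector
orthogonal to itself. -/
theorem orthogonal_iSup_jointEigenspace {A B : H →ₗ.[ℂ] H} (hA : IsSelfAdjoint A)
    (hB : IsSelfAdjoint B) (hAB : StronglyCommute A B) {R : H →L[ℂ] H}
    (hR : IsBoundedInverse (opDelta A B) R) (hRc : IsCompactOperator R) :
    (⨆ p, jointEigenspace A B p)ᗮ = ⊥ := by
  obtain ⟨E, F, hE, hF, hEF⟩ := hAB
  have hPA : ∀ S, MeasurableSet S → ∀ P ∈ ({E.proj S, F.proj S} : Set (H →L[ℂ] H)),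
      IsSelfAdjoint P ∧ Reduces P A ∧ Reduces P B := by
    rintro S hS P (rfl | rfl)
    · exact ⟨(E.isStarProjection S hS).isSelfAdjoint, hE.reduces hA.dense_domain
        (E.isStarProjection S hS) fun T hT => E.commute_proj hT hS, hF.reduces hB.dense_domain
        (E.isStarProjection S hS) fun T hT => (hEF S T hS hT).symm⟩
    · exact ⟨(F.isStarProjection S hS).isSelfAdjoint, hE.reduces hA.dense_domain
        (F.isStarProjection S hS) fun T hT => hEF T S hT hS, hF.reduces hB.dense_domain
        (F.isStarProjection S hS) fun T hT => F.commute_proj hT hS⟩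
  set U := (⨆ p, jointEigenspace A B p)ᗮ with hU
  have hRsym := isSymmetric_of_isBoundedInverse_opDelta hA hB hR
  have hmemU : ∀ x, x ∈ U ↔ ∀ p, ∀ w ∈ jointEigenspace A B p, inner ℂ w x = 0 := by
    intro x
    rw [hU, ← Submodule.iInf_orthogonal]
    simp [Submodule.mem_orthogonal]
  have hRU : ∀ x ∈ U, R x ∈ U := by
    intro x hx
    rw [hmemU] at hx ⊢
    intro p w hw
    have h1 : inner ℂ (R w) x = inner ℂ w (R x) := hRsym w x
    rw [← h1, apply_of_mem_jointEigenspace hR hw, inner_smul_left, hx p w hw, mul_zero]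
  have hPU : ∀ P : H →L[ℂ] H, IsSelfAdjoint P → Reduces P A → Reduces P B → ∀ x ∈ U, P x ∈ U := by
    intro P hP hPA hPB x hx
    rw [hmemU] at hx ⊢
    intro p w hw
    have h3 := ContinuousLinearMap.adjoint_inner_left P x w
    rw [hP.adjoint_eq] at h3
    rw [← h3]
    exact hx p _ ⟨hPA.apply_mem_realEigenspace hw.1, hPB.apply_mem_realEigenspace hw.2⟩
  have key : ∀ μ : ℂ, U ⊓ Module.End.eigenspace (R : Module.End ℂ H) μ = ⊥ := by
    intro μ
    by_cases hμ : μ = 0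
    · rw [Submodule.eq_bot_iff]
      rintro x ⟨-, hx⟩
      have hx' : R x = μ • x := Module.End.mem_eigenspace_iff.1 hx
      exact hR.injective (by rw [hx', hμ, zero_smul])
    by_contra hne
    have hfin := ContinuousLinearMap.finite_dimensional_eigenspace hRc μ hμ
    have hfin' : FiniteDimensional ℂ
        (U ⊓ Module.End.eigenspace (R : Module.End ℂ H) μ : Submodule ℂ H) :=
      Submodule.finiteDimensional_inf_right _ _
    -- An eigenvector with `μ ≠ 0` is `μ⁻¹ R x`, so it lies in the domain of `Δ`.
    have hdom : ∀ x ∈ U ⊓ Module.End.eigenspace (R : Module.End ℂ H) μ,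
        x ∈ A.domain ∧ x ∈ B.domain := by
      rintro x ⟨-, hx⟩
      have h1 := LinearPMap.smul_mem_graph μ⁻¹ (hR.mem_graph x)
      have hx' : R x = μ • x := Module.End.mem_eigenspace_iff.1 hx
      rw [hx', inv_smul_smul₀ hμ] at h1
      obtain ⟨y, z, hy, -, -⟩ := mem_graph_opDelta_iff.1 h1
      obtain ⟨a, b, ha, hb, -⟩ := mem_graph_opMinus_iff.1 hy
      exact ⟨LinearPMap.mem_domain_of_mem_graph ha, LinearPMap.mem_domain_of_mem_graph hb⟩
    have hinv : ∀ P : H →L[ℂ] H, IsSelfAdjoint P ∧ Reduces P A ∧ Reduces P B →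
        ∀ x ∈ U ⊓ Module.End.eigenspace (R : Module.End ℂ H) μ,
          P x ∈ U ⊓ Module.End.eigenspace (R : Module.End ℂ H) μ := by
      rintro P ⟨hP, hPA, hPB⟩ x ⟨hx1, hx2⟩
      refine ⟨hPU P hP hPA hPB x hx1, ?_⟩
      have hx' : R x = μ • x := Module.End.mem_eigenspace_iff.1 hx2
      refine Module.End.mem_eigenspace_iff.2 ?_
      change R (P x) = μ • P x
      rw [hR.comm_of_reduces (hPA.opDelta hPB), hx', map_smul]
    obtain ⟨p, hp⟩ := exists_jointEigenvector hA hB hE hF hEF hne (fun x hx => (hdom x hx).1)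
      (fun x hx => (hdom x hx).2) (fun S hS => hinv _ (hPA S hS _ (by simp)))
      (fun S hS => hinv _ (hPA S hS _ (by simp)))
    refine hp ((Submodule.eq_bot_iff _).2 ?_)
    rintro x ⟨⟨hx, -⟩, hxp⟩
    exact inner_self_eq_zero.1 ((hmemU x).1 hx p x hxp)
  let RU : U →L[ℂ] U := R.restrict hRU
  have hc : IsCompactOperator RU := hRc.restrict' hRU
  have hs : (RU : U →ₗ[ℂ] U).IsSymmetric := hRsym.restrict_invariant hRU
  have h0 := ContinuousLinearMap.orthogonalComplement_iSup_eigenspaces_eq_bot hc hs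
  have h1 : ∀ μ : ℂ, Module.End.eigenspace (RU : Module.End ℂ U) μ = ⊥ := by
    intro μ
    rw [Submodule.eq_bot_iff]
    intro x hx
    have hx' : RU x = μ • x := Module.End.mem_eigenspace_iff.1 hx
    have h2 : (x : H) ∈ U ⊓ Module.End.eigenspace (R : Module.End ℂ H) μ :=
      ⟨x.2, Module.End.mem_eigenspace_iff.2 (congrArg Subtype.val hx')⟩
    rw [key, Submodule.mem_bot] at h2
    exact Subtype.ext h2
  rw [Submodule.eq_bot_iff]
  intro x hx
  have h2 : (⟨x, hx⟩ : U) ∈ (⨆ μ, Module.End.eigenspace (RU : Module.End ℂ U) μ)ᗮ := by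
    simp only [h1, iSup_bot, Submodule.bot_orthogonal_eq_top, Submodule.mem_top]
  rw [h0, Submodule.mem_bot] at h2
  exact congrArg Subtype.val h2

theorem inner_eq_zero_of_mem_realEigenspace {A : H →ₗ.[ℂ] H} (hA : IsSelfAdjoint A) {s t : ℝ}
    (hst : s ≠ t) {x y : H} (hx : x ∈ A.realEigenspace s) (hy : y ∈ A.realEigenspace t) :
    inner ℂ x y = 0 := by
  have h := LinearPMap.inner_graph_of_isSelfAdjoint hA hx hy
  rw [inner_smul_left, inner_smul_right, Complex.conj_ofReal] at h
  have h2 : ((s : ℂ) - t) * inner ℂ x y = 0 := by linear_combination h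
  exact (mul_eq_zero.1 h2).resolve_left (sub_ne_zero.2 (by exact_mod_cast hst))

theorem exists_hilbertBasis_jointEigenvector {A B : H →ₗ.[ℂ] H} (hA : IsSelfAdjoint A)
    (hB : IsSelfAdjoint B) (hAB : StronglyCommute A B) {R : H →L[ℂ] H}
    (hR : IsBoundedInverse (opDelta A B) R) (hRc : IsCompactOperator R) :
    ∃ (ι : Type) (f : HilbertBasis ι ℂ H) (a b : ι → ℝ),
      ∀ i, f i ∈ jointEigenspace A B (a i, b i) := by
  have hfin : ∀ p, FiniteDimensional ℂ (jointEigenspace A B p) := by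
    intro p
    have := ContinuousLinearMap.finite_dimensional_eigenspace hRc
      (1 + (p.1 : ℂ) ^ 2 + (p.2 : ℂ) ^ 2)⁻¹ (inv_ne_zero (one_add_sq_add_sq_ne_zero _ _))
    exact Submodule.finiteDimensional_of_le (S₂ := Module.End.eigenspace (R : Module.End ℂ H) _)
      fun x hx => Module.End.mem_eigenspace_iff.2 (apply_of_mem_jointEigenspace hR hx)
  have hOF : OrthogonalFamily ℂ (fun p => jointEigenspace A B p)
      fun p => (jointEigenspace A B p).subtypeₗᵢ := by
    intro p q hpq x y
    by_cases h1 : p.1 = q.1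
    · exact inner_eq_zero_of_mem_realEigenspace hB (fun h2 => hpq (Prod.ext h1 h2)) x.2.2 y.2.2
    · exact inner_eq_zero_of_mem_realEigenspace hA h1 x.2.1 y.2.1
  have hon := hOF.orthonormal_sigma_orthonormal
    (v_family := fun p => stdOrthonormalBasis ℂ (jointEigenspace A B p))
    fun p => (stdOrthonormalBasis ℂ (jointEigenspace A B p)).orthonormal
  -- The index is a pair of a point of `ℝ × ℝ` and an element of some `Fin n`, so it lives in `Type`
  -- whatever the universe of `H`.
  refine ⟨_, HilbertBasis.mkOfOrthogonalEqBot hon ?_, fun i => i.1.1, fun i => i.1.2, fun i => ?_⟩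
  · rw [← le_bot_iff, ← orthogonal_iSup_jointEigenspace hA hB hAB hR hRc]
    refine Submodule.orthogonal_le (iSup_le fun p x hx => ?_)
    have h1 := (stdOrthonormalBasis ℂ (jointEigenspace A B p)).sum_repr ⟨x, hx⟩
    have h2 := congrArg Subtype.val h1
    rw [← show _ = x from h2, AddSubmonoidClass.coe_finsetSum]
    exact Submodule.sum_mem _ fun j _ => Submodule.smul_mem _ _
      (Submodule.subset_span ⟨⟨p, j⟩, rfl⟩)
  · rw [HilbertBasis.coe_mkOfOrthogonalEqBot]
    exact (stdOrthonormalBasis ℂ (jointEigenspace A B i.1) i.2).2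

end JointEigenspace

/-! ### Diagonal operators and their approximation on finite spans -/

section Diagonal

variable {H : Type*} [NormedAddCommGroup H] [InnerProductSpace ℂ H] {ι : Type*}

theorem HilbertBasis.ext_repr (f : HilbertBasis ι ℂ H) {x y : H}
    (h : ∀ i, f.repr x i = f.repr y i) : x = y :=
  f.repr.injective (lp.ext (funext h))

theorem HilbertBasis.norm_le_of_repr (f : HilbertBasis ι ℂ H) {x y : H} {C : ℝ} (hC : 0 ≤ C)
    (h : ∀ i, ‖f.repr x i‖ ≤ C * ‖f.repr y i‖) : ‖x‖ ≤ C * ‖y‖ := by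
  rw [← f.repr.norm_map x, ← f.repr.norm_map y]
  have h1 : ‖f.repr x‖ ≤ ‖(C : ℂ) • f.repr y‖ := lp.norm_mono (by norm_num) fun i => by
    rw [lp.coeFn_smul, Pi.smul_apply, norm_smul, Complex.norm_real, Real.norm_of_nonneg hC]
    exact h i
  rwa [norm_smul, Complex.norm_real, Real.norm_of_nonneg hC] at h1

theorem HilbertBasis.exists_diagonal (f : HilbertBasis ι ℂ H) {d : ι → ℂ} {C : ℝ}
    (hd : ∀ i, ‖d i‖ ≤ C) :
    ∃ D : H →L[ℂ] H, ∀ x i, f.repr (D x) i = d i * f.repr x i := by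
  have hm : ∀ x : H, Memℓp (fun i => d i * f.repr x i) 2 := fun x =>
    (lp.memℓp ((C : ℂ) • f.repr x)).mono' fun i => by
      rw [lp.coeFn_smul, Pi.smul_apply, norm_smul, norm_mul, Complex.norm_real]
      exact mul_le_mul_of_nonneg_right ((hd i).trans (le_abs_self C)) (norm_nonneg _)
  have hex : ∀ x : H, ∃ y : H, ∀ i, f.repr y i = d i * f.repr x i := fun x =>
    ⟨f.repr.symm ⟨_, hm x⟩, fun i => by rw [LinearIsometryEquiv.apply_symm_apply]⟩
  choose D₀ hr using hex
  let D : H →ₗ[ℂ] H :=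
    { toFun := D₀
      map_add' := fun x y => f.ext_repr fun i => by
        simp only [map_add, lp.coeFn_add, Pi.add_apply, hr, mul_add]
      map_smul' := fun c x => f.ext_repr fun i => by
        simp only [map_smul, lp.coeFn_smul, Pi.smul_apply, hr, smul_eq_mul, RingHom.id_apply]
        ring }
  -- `C` can be negative only when `ι` is empty; the absolute value covers that case.
  refine ⟨D.mkContinuous |C| fun x => f.norm_le_of_repr (abs_nonneg C) fun i => ?_, hr⟩
  rw [show f.repr (D x) i = _ from hr x i, norm_mul]
  exact mul_le_mul_of_nonneg_right ((hd i).trans (le_abs_self C)) (norm_nonneg _)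

theorem HilbertBasis.repr_self_apply [DecidableEq ι] (f : HilbertBasis ι ℂ H) (i j : ι) :
    f.repr (f i) j = if j = i then 1 else 0 := by
  rw [f.repr_apply_apply, orthonormal_iff_ite.1 f.orthonormal]

theorem HilbertBasis.eventually_exists_mem_span {κ : Type*} (e : HilbertBasis κ ℂ H) (x : H)
    {ε : ℝ} (hε : 0 < ε) :
    ∀ᶠ F : Finset κ in atTop, ∃ l ∈ Submodule.span ℂ (e '' (F : Set κ)), ‖x - l‖ ≤ ε := by
  have h := (e.hasSum_repr x).eventually (Metric.closedBall_mem_nhds x hε)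
  rw [SummationFilter.unconditional_filter] at h
  filter_upwards [h] with F hF
  refine ⟨∑ i ∈ F, e.repr x i • e i, Submodule.sum_mem _ fun i hi => Submodule.smul_mem _ _
    (Submodule.subset_span ⟨i, hi, rfl⟩), ?_⟩
  rwa [dist_eq_norm, norm_sub_rev] at hF

/-- `D` is compact. All but finitely many entries are below `ε / 2`, and the finitely many remaining
vectors `f i` are eventually close to the span of `F`. -/
theorem HilbertBasis.eventually_diagonal_approx (f : HilbertBasis ι ℂ H) {κ : Type*}
    (e : HilbertBasis κ ℂ H) {d : ι → ℂ} (hd : Tendsto d cofinite (𝓝 0)) {D : H →L[ℂ] H}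
    (hD : ∀ x i, f.repr (D x) i = d i * f.repr x i) {ε : ℝ} (hε : 0 < ε) :
    ∀ᶠ F : Finset κ in atTop, ∀ x,
      ∃ l ∈ Submodule.span ℂ (e '' (F : Set κ)), ‖D x - l‖ ≤ ε * ‖x‖ := by
  classical
  have hfin : {i | ¬ ‖d i‖ < ε / 2}.Finite := by
    have := hd.eventually (Metric.ball_mem_nhds (0 : ℂ) (half_pos hε))
    simpa using this
  set S : Finset ι := hfin.toFinset with hS
  set M : ℝ := ∑ i ∈ S, ‖d i‖ with hM
  have hM0 : 0 ≤ M := Finset.sum_nonneg fun _ _ => norm_nonneg _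
  -- The errors at `f i`, weighted by `‖d i‖`, sum to at most `M / (M + 1) * (ε / 2)`; the `+ 1`
  -- allows `M = 0`.
  have hδ : 0 < ε / 2 / (M + 1) := by positivity
  have hev : ∀ᶠ F : Finset κ in atTop, ∀ i ∈ S,
      ∃ l ∈ Submodule.span ℂ (e '' (F : Set κ)), ‖f i - l‖ ≤ ε / 2 / (M + 1) :=
    (Finset.eventually_all S).2 fun i _ => e.eventually_exists_mem_span (f i) hδ
  filter_upwards [hev] with F hF x
  choose! l hl hl' using hF
  refine ⟨∑ i ∈ S, (d i * f.repr x i) • l i,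
    Submodule.sum_mem _ fun i hi => Submodule.smul_mem _ _ (hl i hi), ?_⟩
  have h1 : ‖D x - ∑ i ∈ S, (d i * f.repr x i) • f i‖ ≤ ε / 2 * ‖x‖ := by
    refine f.norm_le_of_repr (half_pos hε).le fun j => ?_
    have hj : f.repr (D x - ∑ i ∈ S, (d i * f.repr x i) • f i) j
        = if j ∈ S then 0 else d j * f.repr x j := by
      rw [map_sub, map_sum, lp.coeFn_sub, Pi.sub_apply, hD, lp.coeFn_sum, Finset.sum_apply]
      simp only [map_smul, lp.coeFn_smul, Pi.smul_apply, f.repr_self_apply, smul_eq_mul,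
        mul_ite, mul_one, mul_zero, Finset.sum_ite_eq]
      split_ifs <;> simp
    rw [hj]
    split_ifs with hjS
    · rw [norm_zero]; positivity
    · rw [norm_mul]
      have : ‖d j‖ < ε / 2 := by simpa [hS] using hjS
      exact mul_le_mul_of_nonneg_right this.le (norm_nonneg _)
  have h2 : ‖∑ i ∈ S, (d i * f.repr x i) • f i - ∑ i ∈ S, (d i * f.repr x i) • l i‖
      ≤ ε / 2 * ‖x‖ := by
    rw [← Finset.sum_sub_distrib]
    calc ‖∑ i ∈ S, ((d i * f.repr x i) • f i - (d i * f.repr x i) • l i)‖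
        ≤ ∑ i ∈ S, ‖d i‖ * (‖x‖ * (ε / 2 / (M + 1))) := by
          refine norm_sum_le_of_le _ fun i hi => ?_
          rw [← smul_sub, norm_smul, norm_mul, mul_assoc]
          have hx : ‖f.repr x i‖ ≤ ‖x‖ :=
            (lp.norm_apply_le_norm (by norm_num) _ i).trans_eq (f.repr.norm_map x)
          exact mul_le_mul_of_nonneg_left
            (mul_le_mul hx (hl' i hi) (norm_nonneg _) (norm_nonneg _)) (norm_nonneg _)
      _ = M / (M + 1) * (ε / 2 * ‖x‖) := by rw [← Finset.sum_mul, ← hM]; ring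
      _ ≤ 1 * (ε / 2 * ‖x‖) := by
          refine mul_le_mul_of_nonneg_right ?_ (by positivity)
          rw [div_le_one (by positivity)]; linarith
      _ = ε / 2 * ‖x‖ := one_mul _
  calc _ ≤ _ := norm_sub_le_norm_sub_add_norm_sub _ (∑ i ∈ S, (d i * f.repr x i) • f i) _
    _ ≤ ε * ‖x‖ := by linarith

theorem Orthonormal.tendsto_cofinite_of_isCompactOperator {f : ι → H} (hf : Orthonormal ℂ f)
    {R : H →L[ℂ] H} (hR : IsCompactOperator R) {r : ι → ℝ} (hr : ∀ i, R (f i) = (r i : ℂ) • f i) :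
    Tendsto r cofinite (𝓝 0) := by
  rw [Metric.tendsto_nhds]
  intro δ hδ
  obtain ⟨K, hK, hKR⟩ := hR.image_closedBall_subset_compact (f := (R : H →ₗ[ℂ] H)) 1
  obtain ⟨t, ht, htK⟩ := Metric.totallyBounded_iff.1 hK.totallyBounded (δ / 2) (half_pos hδ)
  have hmem : ∀ i, ∃ y ∈ t, dist (R (f i)) y < δ / 2 := fun i => by
    have h1 : R (f i) ∈ K := hKR ⟨f i, by simp [hf.1 i], rfl⟩
    simpa using htK h1
  choose c hct hc using hmem
  -- Distinct indices with `|r| ≥ δ` have orthogonal images at distance greater than `δ`, so no two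
  -- of them share a ball of radius `δ / 2`.
  refine Set.Finite.of_injOn (f := c) (fun i _ => hct i) (fun i hi j hj hij => ?_) ht
  by_contra hne
  have hi' : δ ≤ |r i| := by simpa using hi
  have h1 : dist (R (f i)) (R (f j)) < δ :=
    (dist_triangle_right _ _ (c i)).trans_lt
      (by have := hc i; have := hc j; rw [hij] at *; linarith)
  rw [dist_eq_norm, hr, hr] at h1
  have h2 : ‖(r i : ℂ) • f i - (r j : ℂ) • f j‖ ^ 2 = |r i| ^ 2 + |r j| ^ 2 := by
    have h3 : inner ℂ ((r i : ℂ) • f i) ((r j : ℂ) • f j) = 0 := by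
      rw [inner_smul_left, inner_smul_right, hf.2 hne]; simp
    rw [norm_sub_sq (𝕜 := ℂ), h3]
    simp [norm_smul, hf.1]
  nlinarith [norm_nonneg ((r i : ℂ) • f i - (r j : ℂ) • f j), sq_nonneg |r j|]

variable [CompleteSpace H]

theorem isMultiplication_of_mem_realEigenspace {A : H →ₗ.[ℂ] H} (hA : IsSelfAdjoint A)
    (f : HilbertBasis ι ℂ H) {a : ι → ℝ} (h : ∀ i, f i ∈ A.realEigenspace (a i)) :
    IsMultiplication f a A := by
  have h2 : ∀ (x : A.domain) (i : ι), f.repr (A x) i = (a i : ℂ) * f.repr (x : H) i := by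
    intro x i
    rw [f.repr_apply_apply, f.repr_apply_apply,
      ← LinearPMap.inner_graph_of_isSelfAdjoint hA (h i) (A.mem_graph x), inner_smul_left,
      Complex.conj_ofReal]
  have hiff : ∀ g : ι → ℂ, Memℓp g 2 ↔ Summable fun i => ‖g i‖ ^ 2 := fun g => by
    rw [memℓp_gen_iff (by norm_num)]
    norm_num
  refine ⟨fun x => ⟨fun hx => ?_, fun hx => ?_⟩, h2⟩
  · have := lp.memℓp (f.repr (A ⟨x, hx⟩))
    rw [hiff] at this
    simpa only [h2] using this
  · rw [← hiff] at hx
    -- Maximality of the domain is where full selfadjointness enters: `x` is shown to lie in the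
    -- domain of the adjoint.
    have hA' := LinearPMap.isSelfAdjoint_def.1 hA
    rw [← hA']
    refine LinearPMap.mem_adjoint_domain_of_exists x ⟨f.repr.symm ⟨_, hx⟩, fun y => ?_⟩
    rw [← f.repr.inner_map_map, ← f.repr.inner_map_map x, LinearIsometryEquiv.apply_symm_apply,
      lp.inner_eq_tsum, lp.inner_eq_tsum]
    refine tsum_congr fun i => ?_
    rw [h2]
    simp only [RCLike.inner_apply, map_mul, Complex.conj_ofReal]
    ring

end Diagonal

/-! ### Counting eigenvalues by min-max -/

section Counting

variable {V : Type*} [NormedAddCommGroup V] [InnerProductSpace ℂ V]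

/-- The spectral subspace `S` above `1/2` meets `W₀` trivially, so `dim S ≤ n`; its complement meets
`W₁` trivially, so `dim S ≥ n`. -/
theorem countAboveHalf_eq [FiniteDimensional ℂ V] {q : V →L[ℂ] V}
    (hq : (q : V →ₗ[ℂ] V).IsSymmetric) {n : ℕ} (hn : Module.finrank ℂ V = n + n)
    {W₀ W₁ : Submodule ℂ V} (hW₀ : n ≤ Module.finrank ℂ W₀) (hW₁ : n ≤ Module.finrank ℂ W₁)
    (h₀ : ∀ v ∈ W₀, v ≠ 0 → (inner ℂ (q v) v).re < 1 / 2 * ‖v‖ ^ 2)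
    (h₁ : ∀ v ∈ W₁, v ≠ 0 → 1 / 2 * ‖v‖ ^ 2 < (inner ℂ (q v) v).re) :
    countAboveHalf q = n := by
  set b := hq.eigenvectorBasis rfl with hb
  set l := hq.eigenvalues rfl with hl
  have hbl : ∀ j, q (b j) = (l j : ℂ) • b j := fun j => hq.apply_eigenvectorBasis rfl j
  have hqv : ∀ v, (inner ℂ (q v) v).re = ∑ j, l j * ‖inner ℂ (b j) v‖ ^ 2 := by
    intro v
    rw [← b.sum_inner_mul_inner (q v) v, Complex.re_sum]
    refine Finset.sum_congr rfl fun j _ => ?_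
    have h1 : inner ℂ (q v) (b j) = inner ℂ v (q (b j)) := hq v (b j)
    rw [h1, hbl, inner_smul_right, mul_assoc, ← inner_conj_symm v (b j),
      ← Complex.normSq_eq_conj_mul_self,
      ← Complex.ofReal_mul, Complex.ofReal_re, Complex.normSq_eq_norm_sq]
  have hv : ∀ v, ‖v‖ ^ 2 = ∑ j, ‖inner ℂ (b j) v‖ ^ 2 := fun v =>
    (b.sum_sq_norm_inner_right v).symm
  set S : Submodule ℂ V :=
    ⨆ (t : ℝ) (_ : 1 / 2 < t), Module.End.eigenspace (q : Module.End ℂ V) (t : ℂ) with hS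
  have hS1 : ∀ v ∈ S, 1 / 2 * ‖v‖ ^ 2 ≤ (inner ℂ (q v) v).re := by
    intro v hvS
    rw [hqv, hv, Finset.mul_sum]
    refine Finset.sum_le_sum fun j _ => ?_
    rcases lt_or_ge (1 / 2) (l j) with hj | hj
    · exact mul_le_mul_of_nonneg_right hj.le (by positivity)
    · have hle : S ≤ (Submodule.span ℂ {b j})ᗮ := by
        refine iSup₂_le fun t ht x hx => ?_
        rw [Submodule.mem_orthogonal_singleton_iff_inner_right]
        have hx' : q x = (t : ℂ) • x := Module.End.mem_eigenspace_iff.1 hx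
        have h1 : inner ℂ (q (b j)) x = inner ℂ (b j) (q x) := hq (b j) x
        rw [hx', hbl, inner_smul_left, inner_smul_right, Complex.conj_ofReal] at h1
        have h2 : ((l j : ℂ) - t) * inner ℂ (b j) x = 0 := by linear_combination h1
        have h3 : (l j : ℂ) ≠ t := by
          intro h; have : l j = t := by exact_mod_cast h
          linarith
        exact (mul_eq_zero.1 h2).resolve_left (sub_ne_zero.2 h3)
      rw [(Submodule.mem_orthogonal_singleton_iff_inner_right).1 (hle hvS)]
      simp
  have hS0 : ∀ v ∈ Sᗮ, (inner ℂ (q v) v).re ≤ 1 / 2 * ‖v‖ ^ 2 := by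
    intro v hvS
    rw [hqv, hv, Finset.mul_sum]
    refine Finset.sum_le_sum fun j _ => ?_
    rcases lt_or_ge (1 / 2) (l j) with hj | hj
    · have : b j ∈ S := Submodule.mem_iSup_of_mem (l j) (Submodule.mem_iSup_of_mem hj
        (Module.End.mem_eigenspace_iff.2 (hbl j)))
      rw [(Submodule.mem_orthogonal _ _).1 hvS _ this]
      simp
    · exact mul_le_mul_of_nonneg_right hj (by positivity)
  have d0 : Disjoint S W₀ := by
    rw [Submodule.disjoint_def]
    intro v hvS hvW
    by_contra h
    exact absurd (h₀ v hvW h) (not_lt.2 (hS1 v hvS))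
  have d1 : Disjoint Sᗮ W₁ := by
    rw [Submodule.disjoint_def]
    intro v hvS hvW
    by_contra h
    exact absurd (h₁ v hvW h) (not_lt.2 (hS0 v hvS))
  have e0 := Submodule.finrank_add_finrank_le_of_disjoint d0
  have e1 := Submodule.finrank_add_finrank_le_of_disjoint d1
  have e2 := Submodule.finrank_add_finrank_orthogonal S
  change Module.finrank ℂ S = n
  omega

end Counting

/-! ### Compressions of a projection -/

section Corner

variable {K : Type*} [NormedAddCommGroup K] [InnerProductSpace ℂ K]
  {M : Submodule ℂ K} [FiniteDimensional ℂ M] {Q : K →L[ℂ] K}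

/-- The compression of an operator to a finite-dimensional subspace. -/
noncomputable def compression (M : Submodule ℂ K) [FiniteDimensional ℂ M] (Q : K →L[ℂ] K) :
    M →L[ℂ] M :=
  M.orthogonalProjectionOnto ∘L Q ∘L M.subtypeL

theorem inner_compression (v w : M) : inner ℂ (compression M Q v) w = inner ℂ (Q v) (w : K) :=
  M.inner_orthogonalProjectionOnto_eq_of_mem_right w (Q v)

theorem isSymmetric_compression (hQ : (Q : K →ₗ[ℂ] K).IsSymmetric) :
    (compression M Q : M →ₗ[ℂ] M).IsSymmetric := by
  intro v w
  change inner ℂ (compression M Q v) w = inner ℂ v (compression M Q w)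
  rw [inner_compression, ← inner_conj_symm v, inner_compression, inner_conj_symm]
  exact hQ v w

theorem norm_apply_le_of_isSymmetric_of_idem (hQ : (Q : K →ₗ[ℂ] K).IsSymmetric)
    (hQ2 : ∀ x, Q (Q x) = Q x) (x : K) : ‖Q x‖ ≤ ‖x‖ := by
  have h1 : inner ℂ (Q x) (Q x) = inner ℂ x (Q x) := by
    have : inner ℂ (Q x) (Q x) = inner ℂ x (Q (Q x)) := hQ x (Q x)
    rwa [hQ2] at this
  have h2 := norm_inner_le_norm (𝕜 := ℂ) x (Q x)
  rw [← h1, inner_self_eq_norm_sq_to_K] at h2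
  simp only [Complex.coe_algebraMap, norm_pow, Complex.norm_real, norm_norm] at h2
  by_contra! h
  nlinarith [norm_nonneg x]

theorem norm_compression_sq_sub_le (hQ : (Q : K →ₗ[ℂ] K).IsSymmetric)
    (hQ2 : ∀ x, Q (Q x) = Q x) {ε : ℝ} (hε : 0 ≤ ε)
    (h : ∀ v ∈ M, ‖Q v - M.starProjection (Q v)‖ ≤ ε * ‖v‖) :
    ‖compression M Q * compression M Q - compression M Q‖ ≤ ε := by
  refine ContinuousLinearMap.opNorm_le_bound _ hε fun v => ?_
  -- With `P` the projection onto `M` and `Q² = Q`, on `M` one has `q² - q = P Q (P - 1) Q`.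
  have h1 : (compression M Q * compression M Q - compression M Q) v =
      M.orthogonalProjectionOnto (Q (M.starProjection (Q v) - Q v)) := by
    rw [map_sub, map_sub, hQ2]
    rfl
  rw [h1]
  calc _ ≤ ‖Q (M.starProjection (Q v) - Q v)‖ := M.norm_orthogonalProjectionOnto_apply_le _
    _ ≤ ‖M.starProjection (Q v) - Q v‖ := norm_apply_le_of_isSymmetric_of_idem hQ hQ2 _
    _ ≤ ε * ‖v‖ := by rw [norm_sub_rev]; exact h v v.2

/-- The test subspaces are the compressions to `M` of `U M₀` and `U M₁`. The form of `q` at `g x` is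
`‖Q (g x)‖²`, and `g x` is within `‖x‖ / 8` of `U x`. The two comparisons reduce to `1/64 < 49/128`
and `1/2 < 49/64`. -/
theorem countAboveHalf_compression (hQ : (Q : K →ₗ[ℂ] K).IsSymmetric)
    (hQ2 : ∀ x, Q (Q x) = Q x) {U : K →L[ℂ] K} (hU : ∀ x, ‖U x‖ = ‖x‖) {n : ℕ}
    (hn : Module.finrank ℂ M = n + n) {M₀ M₁ : Submodule ℂ K} (hM₀ : M₀ ≤ M) (hM₁ : M₁ ≤ M)
    (hn₀ : Module.finrank ℂ M₀ = n) (hn₁ : Module.finrank ℂ M₁ = n)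
    (hU₀ : ∀ x ∈ M₀, Q (U x) = 0) (hU₁ : ∀ x ∈ M₁, Q (U x) = U x)
    (h : ∀ v ∈ M, ‖U v - M.starProjection (U v)‖ ≤ 1 / 8 * ‖v‖) :
    countAboveHalf (compression M Q) = n := by
  let g : K →ₗ[ℂ] M := (M.orthogonalProjectionOnto ∘L U : K →L[ℂ] M)
  have hg : ∀ x, ((g x : M) : K) = M.starProjection (U x) := fun x => rfl
  have hinj : ∀ N ≤ M, Function.Injective (g ∘ₗ N.subtype) := by
    intro N hN
    rw [← LinearMap.ker_eq_bot, LinearMap.ker_eq_bot']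
    intro x hx
    have h1 : M.starProjection (U x) = 0 := by
      rw [← hg, show g x = 0 from hx, Submodule.coe_zero]
    have h2 := h x (hN x.2)
    rw [h1, sub_zero, hU] at h2
    have h3 : ‖(x : K)‖ ≤ 0 := by linarith [norm_nonneg (x : K)]
    exact Subtype.ext (norm_le_zero_iff.1 h3)
  have hqv : ∀ x, (inner ℂ (compression M Q (g x)) (g x)).re = ‖Q (g x)‖ ^ 2 := by
    intro x
    rw [inner_compression, ← inner_self_eq_norm_sq (𝕜 := ℂ) (Q (g x))]
    have h1 : inner ℂ (Q (g x)) (Q (g x)) = inner ℂ (Q (Q (g x))) ((g x : M) : K) :=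
      (hQ (Q (g x)) (g x)).symm
    rw [h1, hQ2]
    rfl
  have hQle := norm_apply_le_of_isSymmetric_of_idem hQ hQ2
  refine countAboveHalf_eq (isSymmetric_compression hQ) hn
    (W₀ := LinearMap.range (g ∘ₗ M₀.subtype)) (W₁ := LinearMap.range (g ∘ₗ M₁.subtype)) ?_ ?_ ?_ ?_
  · rw [LinearMap.finrank_range_of_inj (hinj _ hM₀), hn₀]
  · rw [LinearMap.finrank_range_of_inj (hinj _ hM₁), hn₁]
  · rintro _ ⟨x, rfl⟩ hx
    change g x ≠ 0 at hx
    change (inner ℂ (compression M Q (g x)) (g x)).re < 1 / 2 * ‖g x‖ ^ 2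
    rw [hqv, Submodule.coe_norm]
    have hx0 : 0 < ‖(x : K)‖ := norm_pos_iff.2 fun h0 => hx (by rw [h0, map_zero])
    have h1 := h x (hM₀ x.2)
    rw [← hg] at h1
    have h2 : ‖Q (g x)‖ ≤ 1 / 8 * ‖(x : K)‖ := by
      have h3 := hQle (U x - g x)
      rw [map_sub, hU₀ x x.2, zero_sub, norm_neg] at h3
      exact h3.trans h1
    have h4 : 7 / 8 * ‖(x : K)‖ ≤ ‖((g x : M) : K)‖ := by
      have := norm_sub_norm_le (U x) (g x)
      rw [hU] at this
      linarith
    nlinarith [norm_nonneg (Q (g x))]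
  · rintro _ ⟨x, rfl⟩ hx
    change g x ≠ 0 at hx
    change 1 / 2 * ‖g x‖ ^ 2 < (inner ℂ (compression M Q (g x)) (g x)).re
    rw [hqv, Submodule.coe_norm]
    have hx0 : 0 < ‖(x : K)‖ := norm_pos_iff.2 fun h0 => hx (by rw [h0, map_zero])
    have h1 := h x (hM₁ x.2)
    rw [← hg] at h1
    have h2 : 7 / 8 * ‖(x : K)‖ ≤ ‖Q (g x)‖ := by
      have h3 := hQle (U x - g x)
      rw [map_sub, hU₁ x x.2] at h3
      have := norm_sub_norm_le (U x) (Q (g x))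
      rw [hU] at this
      linarith
    have h4 : ‖((g x : M) : K)‖ ≤ ‖(x : K)‖ := by
      rw [hg, ← hU x]
      exact M.norm_starProjection_apply_le _
    nlinarith [norm_nonneg ((g x : M) : K)]

end Corner

/-! ### Block diagonal operators on `H ⊕ H` -/

section BlockDiagonal

variable {H : Type*} [NormedAddCommGroup H] [InnerProductSpace ℂ H] {ι : Type*}

/-- In the orthonormal basis `f`, the operator `T` on `H ⊕ H` maps each `ℂ f i ⊕ ℂ f i` into
itself, acting there by the matrix `m i`. -/
def IsBlockDiagonal (f : HilbertBasis ι ℂ H) (m : ι → Matrix (Fin 2) (Fin 2) ℂ)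
    (T : WithLp 2 (H × H) →L[ℂ] WithLp 2 (H × H)) : Prop :=
  ∀ v i,
    f.repr (T v).fst i = m i 0 0 * f.repr v.fst i + m i 0 1 * f.repr v.snd i ∧
    f.repr (T v).snd i = m i 1 0 * f.repr v.fst i + m i 1 1 * f.repr v.snd i

theorem HilbertBasis.ext_repr_prod (f : HilbertBasis ι ℂ H) {v w : WithLp 2 (H × H)}
    (h₁ : ∀ i, f.repr v.fst i = f.repr w.fst i) (h₂ : ∀ i, f.repr v.snd i = f.repr w.snd i) :
    v = w :=
  WithLp.ofLp_injective 2 (Prod.ext (f.ext_repr h₁) (f.ext_repr h₂))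

theorem exists_isBlockDiagonal (f : HilbertBasis ι ℂ H) {m : ι → Matrix (Fin 2) (Fin 2) ℂ} {C : ℝ}
    (hm : ∀ i j k, ‖m i j k‖ ≤ C) : ∃ T, IsBlockDiagonal f m T := by
  have h : ∀ j k, ∃ D : H →L[ℂ] H, ∀ x i, f.repr (D x) i = m i j k * f.repr x i := fun j k =>
    f.exists_diagonal (d := fun i => m i j k) fun i => hm i j k
  choose D hD using h
  let e := WithLp.prodContinuousLinearEquiv 2 ℂ H H
  refine ⟨e.symm ∘L (((D 0 0).coprod (D 0 1)).prod ((D 1 0).coprod (D 1 1))) ∘L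
    (e : WithLp 2 (H × H) →L[ℂ] H × H), fun v i => ⟨?_, ?_⟩⟩
  · change f.repr (D 0 0 v.fst + D 0 1 v.snd) i = _
    rw [map_add, lp.coeFn_add, Pi.add_apply, hD, hD]
  · change f.repr (D 1 0 v.fst + D 1 1 v.snd) i = _
    rw [map_add, lp.coeFn_add, Pi.add_apply, hD, hD]

theorem IsBlockDiagonal.comp {f : HilbertBasis ι ℂ H} {m m' : ι → Matrix (Fin 2) (Fin 2) ℂ}
    {T T' : WithLp 2 (H × H) →L[ℂ] WithLp 2 (H × H)} (h : IsBlockDiagonal f m T)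
    (h' : IsBlockDiagonal f m' T') : IsBlockDiagonal f (fun i => m i * m' i) (T ∘L T') := by
  intro v i
  simp only [ContinuousLinearMap.comp_apply, (h _ i).1, (h _ i).2, (h' _ i).1, (h' _ i).2,
    Matrix.mul_apply, Fin.sum_univ_two]
  exact ⟨by ring, by ring⟩

theorem IsBlockDiagonal.unique {f : HilbertBasis ι ℂ H} {m : ι → Matrix (Fin 2) (Fin 2) ℂ}
    {T T' : WithLp 2 (H × H) →L[ℂ] WithLp 2 (H × H)} (h : IsBlockDiagonal f m T)
    (h' : IsBlockDiagonal f m T') (v : WithLp 2 (H × H)) : T v = T' v :=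
  f.ext_repr_prod (fun i => by rw [(h v i).1, (h' v i).1])
    fun i => by rw [(h v i).2, (h' v i).2]

theorem isBlockDiagonal_one (f : HilbertBasis ι ℂ H) : IsBlockDiagonal f (fun _ => 1) 1 := by
  intro v i
  simp

theorem HilbertBasis.hasSum_inner_prod (f : HilbertBasis ι ℂ H) (v w : WithLp 2 (H × H)) :
    HasSum (fun i => (starRingEnd ℂ) (f.repr v.fst i) * f.repr w.fst i +
      (starRingEnd ℂ) (f.repr v.snd i) * f.repr w.snd i) (inner ℂ v w) := by
  rw [WithLp.prod_inner_apply]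
  have h : ∀ x y : H,
      HasSum (fun i => (starRingEnd ℂ) (f.repr x i) * f.repr y i) (inner ℂ x y) := fun x y => by
    have := lp.hasSum_inner (𝕜 := ℂ) (f.repr x) (f.repr y)
    rw [f.repr.inner_map_map] at this
    simpa only [RCLike.inner_apply, mul_comm] using this
  exact (h _ _).add (h _ _)

theorem IsBlockDiagonal.inner_apply {f : HilbertBasis ι ℂ H} {m : ι → Matrix (Fin 2) (Fin 2) ℂ}
    {T T' : WithLp 2 (H × H) →L[ℂ] WithLp 2 (H × H)} (h : IsBlockDiagonal f m T)
    (h' : IsBlockDiagonal f (fun i => (m i).conjTranspose) T') (v w : WithLp 2 (H × H)) :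
    inner ℂ (T v) w = inner ℂ v (T' w) := by
  refine (f.hasSum_inner_prod (T v) w).unique ?_
  convert f.hasSum_inner_prod v (T' w) using 1
  funext i
  simp only [(h _ i).1, (h _ i).2, (h' _ i).1, (h' _ i).2, Matrix.conjTranspose_apply, map_add,
    map_mul, Complex.star_def]
  ring

theorem IsBlockDiagonal.norm_apply {f : HilbertBasis ι ℂ H} {m : ι → Matrix (Fin 2) (Fin 2) ℂ}
    {T : WithLp 2 (H × H) →L[ℂ] WithLp 2 (H × H)} (h : IsBlockDiagonal f m T)
    (hm : ∀ i, (m i).conjTranspose * m i = 1) {C : ℝ} (hC : ∀ i j k, ‖m i j k‖ ≤ C)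
    (v : WithLp 2 (H × H)) : ‖T v‖ = ‖v‖ := by
  obtain ⟨T', h'⟩ := exists_isBlockDiagonal f (m := fun i => (m i).conjTranspose) (C := C)
    fun i j k => by rw [Matrix.conjTranspose_apply, norm_star]; exact hC i k j
  have h2 : inner ℂ (T v) (T v) = inner ℂ v v := by
    have h3 := h'.comp h
    simp only [hm] at h3
    rw [h.inner_apply h', show T' (T v) = v from h3.unique (isBlockDiagonal_one f) v]
  rw [inner_self_eq_norm_sq_to_K, inner_self_eq_norm_sq_to_K] at h2
  have h4 : ‖T v‖ ^ 2 = ‖v‖ ^ 2 := by exact_mod_cast h2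
  exact (sq_eq_sq₀ (norm_nonneg _) (norm_nonneg _)).1 h4

theorem mem_doubleSpan_iff {κ : Type*} {e : HilbertBasis κ ℂ H} {F : Finset κ}
    {v : WithLp 2 (H × H)} :
    v ∈ doubleSpan e F ↔ v.fst ∈ Submodule.span ℂ (e '' (F : Set κ)) ∧
      v.snd ∈ Submodule.span ℂ (e '' (F : Set κ)) := by
  constructor
  · rintro ⟨x, hx, rfl⟩
    exact hx
  · intro h
    exact ⟨WithLp.ofLp v, h, rfl⟩

/-- `T` is a constant diagonal matrix, which preserves `L ⊕ L` exactly, plus a `2 × 2` matrix of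
compact diagonal operators, each approximated within `ε / 4`. -/
theorem IsBlockDiagonal.eventually_approx {f : HilbertBasis ι ℂ H}
    {m : ι → Matrix (Fin 2) (Fin 2) ℂ} {C : ℝ} (hC : ∀ i j k, ‖m i j k‖ ≤ C)
    {T : WithLp 2 (H × H) →L[ℂ] WithLp 2 (H × H)} (h : IsBlockDiagonal f m T) {d : Fin 2 → ℂ}
    (hd : ∀ j k, Tendsto (fun i => m i j k - Matrix.diagonal d j k) cofinite (𝓝 0)) {κ : Type*}
    (e : HilbertBasis κ ℂ H) {ε : ℝ} (hε : 0 < ε) :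
    ∀ᶠ F : Finset κ in atTop, ∀ v ∈ doubleSpan e F,
      ‖T v - (doubleSpan e F).starProjection (T v)‖ ≤ ε * ‖v‖ := by
  have hex : ∀ j k, ∃ D : H →L[ℂ] H,
      ∀ x i, f.repr (D x) i = (m i j k - Matrix.diagonal d j k) * f.repr x i := fun j k =>
    f.exists_diagonal (d := fun i => m i j k - Matrix.diagonal d j k)
      (C := C + ‖Matrix.diagonal d j k‖) fun i =>
        (norm_sub_le _ _).trans (add_le_add_left (hC i j k) _)
  choose D hD using hex
  have hev : ∀ᶠ F : Finset κ in atTop, ∀ j k x,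
      ∃ l ∈ Submodule.span ℂ (e '' (F : Set κ)), ‖D j k x - l‖ ≤ ε / 4 * ‖x‖ :=
    eventually_all.2 fun j => eventually_all.2 fun k =>
      f.eventually_diagonal_approx e (hd j k) (hD j k) (by positivity)
  filter_upwards [hev] with F hF v hv
  choose l hl hl' using hF
  have hv' := mem_doubleSpan_iff.1 hv
  have hT1 : (T v).fst = d 0 • v.fst + (D 0 0 v.fst + D 0 1 v.snd) := f.ext_repr fun i => by
    simp only [(h v i).1, map_add, lp.coeFn_add, Pi.add_apply, hD, map_smul, lp.coeFn_smul,
      Pi.smul_apply, smul_eq_mul, Matrix.diagonal_apply]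
    simp
    ring
  have hT2 : (T v).snd = d 1 • v.snd + (D 1 0 v.fst + D 1 1 v.snd) := f.ext_repr fun i => by
    simp only [(h v i).2, map_add, lp.coeFn_add, Pi.add_apply, hD, map_smul, lp.coeFn_smul,
      Pi.smul_apply, smul_eq_mul, Matrix.diagonal_apply]
    simp
    ring
  let u : WithLp 2 (H × H) := WithLp.toLp 2
    (d 0 • v.fst + (l 0 0 v.fst + l 0 1 v.snd), d 1 • v.snd + (l 1 0 v.fst + l 1 1 v.snd))
  have hu : u ∈ doubleSpan e F := mem_doubleSpan_iff.2
    ⟨Submodule.add_mem _ (Submodule.smul_mem _ _ hv'.1) (Submodule.add_mem _ (hl _ _ _) (hl _ _ _)),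
      Submodule.add_mem _ (Submodule.smul_mem _ _ hv'.2)
        (Submodule.add_mem _ (hl _ _ _) (hl _ _ _))⟩
  -- The projection gives the nearest point, so any `u` in `L ⊕ L` bounds the distance.
  have hmin : ‖T v - (doubleSpan e F).starProjection (T v)‖ ≤ ‖T v - u‖ := by
    rw [Submodule.starProjection_minimal]
    exact ciInf_le ⟨0, by rintro _ ⟨w, rfl⟩; exact norm_nonneg _⟩ (⟨u, hu⟩ : doubleSpan e F)
  refine hmin.trans ?_
  have h1 : ‖(T v - u).fst‖ ≤ ε / 4 * ‖v.fst‖ + ε / 4 * ‖v.snd‖ := by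
    have : (T v - u).fst = (D 0 0 v.fst - l 0 0 v.fst) + (D 0 1 v.snd - l 0 1 v.snd) := by
      rw [WithLp.sub_fst, hT1]
      change _ - (d 0 • v.fst + (l 0 0 v.fst + l 0 1 v.snd)) = _
      abel
    rw [this]
    exact norm_add_le_of_le (hl' _ _ _) (hl' _ _ _)
  have h2 : ‖(T v - u).snd‖ ≤ ε / 4 * ‖v.fst‖ + ε / 4 * ‖v.snd‖ := by
    have : (T v - u).snd = (D 1 0 v.fst - l 1 0 v.fst) + (D 1 1 v.snd - l 1 1 v.snd) := by
      rw [WithLp.sub_snd, hT2]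
      change _ - (d 1 • v.snd + (l 1 0 v.fst + l 1 1 v.snd)) = _
      abel
    rw [this]
    exact norm_add_le_of_le (hl' _ _ _) (hl' _ _ _)
  have h3 := WithLp.prod_norm_sq_eq_of_L2 (T v - u)
  have h4 := WithLp.prod_norm_sq_eq_of_L2 v
  have h5 : ‖v.fst‖ ≤ ‖v‖ := by nlinarith [norm_nonneg v, norm_nonneg v.fst, sq_nonneg ‖v.snd‖]
  have h6 : ‖v.snd‖ ≤ ‖v‖ := by nlinarith [norm_nonneg v, norm_nonneg v.snd, sq_nonneg ‖v.fst‖]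
  have h7 : ‖(T v - u).fst‖ ≤ ε / 2 * ‖v‖ := by nlinarith
  have h8 : ‖(T v - u).snd‖ ≤ ε / 2 * ‖v‖ := by nlinarith
  have h9 : 0 ≤ ε * ‖v‖ := by positivity
  refine le_of_sq_le_sq ?_ h9
  rw [h3]
  nlinarith [norm_nonneg (T v - u).fst, norm_nonneg (T v - u).snd]

theorem finrank_span_image {κ : Type*} (e : HilbertBasis κ ℂ H) (F : Finset κ) :
    Module.finrank ℂ (Submodule.span ℂ (e '' (F : Set κ))) = F.card := by
  have h := finrank_span_eq_card (e.orthonormal.linearIndependent.comp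
    (fun i : F => (i : κ)) Subtype.val_injective)
  have hr : e '' (F : Set κ) = Set.range (e ∘ fun i : F => (i : κ)) := by
    ext x
    simp
  rw [hr, h, Fintype.card_coe]

/-- The subspace `L ⊕ 0` of `H ⊕ H`. -/
def spanLeft {κ : Type*} (e : HilbertBasis κ ℂ H) (F : Finset κ) :
    Submodule ℂ (WithLp 2 (H × H)) :=
  ((Submodule.span ℂ (e '' (F : Set κ))).map (LinearMap.inl ℂ H H)).map
    (WithLp.linearEquiv 2 ℂ (H × H)).symm.toLinearMap

/-- The subspace `0 ⊕ L` of `H ⊕ H`. -/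
def spanRight {κ : Type*} (e : HilbertBasis κ ℂ H) (F : Finset κ) :
    Submodule ℂ (WithLp 2 (H × H)) :=
  ((Submodule.span ℂ (e '' (F : Set κ))).map (LinearMap.inr ℂ H H)).map
    (WithLp.linearEquiv 2 ℂ (H × H)).symm.toLinearMap

theorem finrank_spanLeft {κ : Type*} (e : HilbertBasis κ ℂ H) (F : Finset κ) :
    Module.finrank ℂ (spanLeft e F) = F.card := by
  rw [spanLeft, LinearEquiv.finrank_map_eq, ← finrank_span_image e F]
  exact (Submodule.equivMapOfInjective _ LinearMap.inl_injective _).finrank_eq.symm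

theorem finrank_spanRight {κ : Type*} (e : HilbertBasis κ ℂ H) (F : Finset κ) :
    Module.finrank ℂ (spanRight e F) = F.card := by
  rw [spanRight, LinearEquiv.finrank_map_eq, ← finrank_span_image e F]
  exact (Submodule.equivMapOfInjective _ LinearMap.inr_injective _).finrank_eq.symm

theorem mem_spanLeft_iff {κ : Type*} {e : HilbertBasis κ ℂ H} {F : Finset κ}
    {v : WithLp 2 (H × H)} :
    v ∈ spanLeft e F ↔ v.fst ∈ Submodule.span ℂ (e '' (F : Set κ)) ∧ v.snd = 0 := by
  constructor
  · rintro ⟨_, ⟨x, hx, rfl⟩, rfl⟩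
    exact ⟨hx, rfl⟩
  · rintro ⟨h, h0⟩
    exact ⟨_, ⟨v.fst, h, rfl⟩, WithLp.ofLp_injective 2 (Prod.ext rfl h0.symm)⟩

theorem mem_spanRight_iff {κ : Type*} {e : HilbertBasis κ ℂ H} {F : Finset κ}
    {v : WithLp 2 (H × H)} :
    v ∈ spanRight e F ↔ v.fst = 0 ∧ v.snd ∈ Submodule.span ℂ (e '' (F : Set κ)) := by
  constructor
  · rintro ⟨_, ⟨x, hx, rfl⟩, rfl⟩
    exact ⟨rfl, hx⟩
  · rintro ⟨h0, h⟩
    exact ⟨_, ⟨v.snd, h, rfl⟩, WithLp.ofLp_injective 2 (Prod.ext h0.symm rfl)⟩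

theorem finrank_doubleSpan {κ : Type*} (e : HilbertBasis κ ℂ H) (F : Finset κ) :
    Module.finrank ℂ (doubleSpan e F) = F.card + F.card := by
  have : FiniteDimensional ℂ (Submodule.span ℂ (e '' (F : Set κ))) :=
    FiniteDimensional.span_of_finite ℂ (F.finite_toSet.image _)
  let g : (Submodule.span ℂ (e '' (F : Set κ))).prod (Submodule.span ℂ (e '' (F : Set κ))) ≃ₗ[ℂ]
      Submodule.span ℂ (e '' (F : Set κ)) × Submodule.span ℂ (e '' (F : Set κ)) :=
    { toFun := fun x => (⟨x.1.1, x.2.1⟩, ⟨x.1.2, x.2.2⟩)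
      invFun := fun x => ⟨(x.1, x.2), x.1.2, x.2.2⟩
      map_add' := fun _ _ => rfl
      map_smul' := fun _ _ => rfl
      left_inv := fun _ => rfl
      right_inv := fun _ => rfl }
  rw [doubleSpan, LinearEquiv.finrank_map_eq, g.finrank_eq, Module.finrank_prod,
    finrank_span_image]

end BlockDiagonal

/-! ### The Bott projection and its rotation to `diag(0, 1)` -/

section Bott

/-- `1 / √(1 + |z|²)`. -/
noncomputable def bottScale (z : ℂ) : ℝ := (√(1 + ‖z‖ ^ 2))⁻¹

/-- A unitary matrix which takes `(0, 1)` into the range and `(1, 0)` into the kernel of the Bott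
projection at `z`. -/
noncomputable def bottRotation (z : ℂ) : Matrix (Fin 2) (Fin 2) ℂ :=
  !![(‖z‖ : ℂ) * bottScale z, Complex.exp (Complex.arg z * Complex.I) * bottScale z;
     -((starRingEnd ℂ) (Complex.exp (Complex.arg z * Complex.I)) * bottScale z),
     (‖z‖ : ℂ) * bottScale z]

theorem bottScale_pos (z : ℂ) : 0 < bottScale z := by
  unfold bottScale; positivity

theorem bottScale_sq (z : ℂ) : bottScale z ^ 2 = (1 + ‖z‖ ^ 2)⁻¹ := by
  rw [bottScale, inv_pow, Real.sq_sqrt (by positivity)]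

theorem bottScale_sq_mul (z : ℂ) : bottScale z ^ 2 * (1 + ‖z‖ ^ 2) = 1 := by
  rw [bottScale_sq, inv_mul_cancel₀ (by positivity)]

theorem bottScale_sq_mul' (z : ℂ) : (bottScale z : ℂ) ^ 2 * (1 + (‖z‖ : ℂ) ^ 2) = 1 := by
  exact_mod_cast bottScale_sq_mul z

theorem bott_eq (z : ℂ) : bott z =
    !![(bottScale z : ℂ) ^ 2, z * (bottScale z : ℂ) ^ 2;
       (starRingEnd ℂ) z * (bottScale z : ℂ) ^ 2, 1 - (bottScale z : ℂ) ^ 2] := by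
  have h : (bottScale z : ℂ) ^ 2 = (1 + (‖z‖ : ℂ) ^ 2)⁻¹ := by exact_mod_cast bottScale_sq z
  rw [bott, h]
  simp only [div_eq_mul_inv, one_mul]

theorem conjTranspose_bott (z : ℂ) : (bott z).conjTranspose = bott z := by
  rw [bott_eq]
  ext j k
  fin_cases j <;> fin_cases k <;> simp [Matrix.conjTranspose_apply]

theorem bott_mul_bott (z : ℂ) : bott z * bott z = bott z := by
  have h := bottScale_sq_mul' z
  have h2 : z * (starRingEnd ℂ) z = (‖z‖ : ℂ) ^ 2 := Complex.mul_conj' z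
  rw [bott_eq]
  generalize (bottScale z : ℂ) = c at *
  ext j k
  fin_cases j <;> fin_cases k <;>
    simp only [Matrix.mul_apply, Fin.sum_univ_two, Matrix.of_apply, Matrix.cons_val',
      Matrix.cons_val_zero,
      Matrix.cons_val_one, Fin.zero_eta, Fin.mk_one, Matrix.cons_val_fin_one]
  · linear_combination c ^ 2 * h + c ^ 4 * h2
  · ring
  · ring
  · linear_combination c ^ 2 * h + c ^ 4 * h2

theorem rank_bott (z : ℂ) : (bott z).rank = 1 := by
  have h := bottScale_sq_mul' z
  have h2 : z * (starRingEnd ℂ) z = (‖z‖ : ℂ) ^ 2 := Complex.mul_conj' z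
  apply le_antisymm
  -- Since `1 - s² = |z|² s²` for `s = bottScale z`, the matrix is the outer product of `s² (1, z̄)`
  -- and `(1, z)`.
  · have : bott z = Matrix.vecMulVec
        ![(bottScale z : ℂ) ^ 2, (starRingEnd ℂ) z * (bottScale z : ℂ) ^ 2]
        ![1, z] := by
      rw [bott_eq]
      generalize (bottScale z : ℂ) = c at *
      ext j k
      fin_cases j <;> fin_cases k <;> simp [Matrix.vecMulVec_apply]
      · ring
      · linear_combination -h - c ^ 2 * h2
    rw [this]
    exact Matrix.rank_vecMulVec_le _ _
  · rw [Nat.one_le_iff_ne_zero]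
    intro h0
    rw [Matrix.rank, Submodule.finrank_eq_zero, LinearMap.range_eq_bot] at h0
    have h3 := congrFun (LinearMap.congr_fun h0 ![1, 0]) 0
    rw [Matrix.mulVecLin_apply, bott_eq] at h3
    have h4 : (bottScale z : ℂ) ≠ 0 := by exact_mod_cast (bottScale_pos z).ne'
    simp [h4] at h3

theorem exp_arg_mul_conj (z : ℂ) : Complex.exp (Complex.arg z * Complex.I) *
    (starRingEnd ℂ) (Complex.exp (Complex.arg z * Complex.I)) = 1 := by
  rw [Complex.mul_conj', Complex.norm_exp_ofReal_mul_I]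
  simp

theorem conjTranspose_bottRotation_mul (z : ℂ) :
    (bottRotation z).conjTranspose * bottRotation z = 1 := by
  have h := bottScale_sq_mul' z
  have h2 := exp_arg_mul_conj z
  rw [bottRotation]
  generalize Complex.exp (Complex.arg z * Complex.I) = w at *
  ext j k
  fin_cases j <;> fin_cases k <;>
    simp only [Matrix.mul_apply, Fin.sum_univ_two, Matrix.of_apply, Matrix.cons_val',
      Matrix.cons_val_zero, Matrix.cons_val_one, Fin.zero_eta, Fin.mk_one, Matrix.cons_val_fin_one,
      Matrix.conjTranspose_apply, Complex.star_def, map_mul, map_neg, Complex.conj_ofReal,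
      Complex.conj_conj, Matrix.one_apply, if_true, zero_ne_one, one_ne_zero, if_false]
  · linear_combination h + (bottScale z : ℂ) ^ 2 * h2
  · ring
  · ring
  · linear_combination h + (bottScale z : ℂ) ^ 2 * h2

theorem bott_mul_bottRotation (z : ℂ) :
    bott z * bottRotation z = bottRotation z * Matrix.diagonal ![0, 1] := by
  have h := bottScale_sq_mul' z
  have h2 := exp_arg_mul_conj z
  have h3 := Complex.norm_mul_exp_arg_mul_I z
  have h4 := congrArg (starRingEnd ℂ) h3
  rw [map_mul, Complex.conj_ofReal] at h4
  rw [bott_eq, bottRotation, ← h4]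
  generalize Complex.exp (Complex.arg z * Complex.I) = w at *
  generalize (bottScale z : ℂ) = c at *
  generalize (starRingEnd ℂ) w = w' at *
  generalize (‖z‖ : ℂ) = r at *
  subst h3
  ext j k
  fin_cases j <;> fin_cases k <;>
    simp only [Matrix.mul_apply, Fin.sum_univ_two, Matrix.of_apply, Matrix.cons_val',
      Matrix.cons_val_zero, Matrix.cons_val_one, Fin.zero_eta, Fin.mk_one, Matrix.cons_val_fin_one,
      Matrix.diagonal_apply, if_true, zero_ne_one, one_ne_zero, if_false]
  · linear_combination -r * c ^ 3 * h2
  · linear_combination w * c * h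
  · linear_combination w' * c * h
  · linear_combination r * c ^ 3 * h2

theorem bottScale_le_one (z : ℂ) : bottScale z ≤ 1 := by
  nlinarith [bottScale_sq_mul z, bottScale_pos z, sq_nonneg (bottScale z * ‖z‖)]

theorem norm_mul_bottScale_le_one (z : ℂ) : ‖z‖ * bottScale z ≤ 1 := by
  nlinarith [bottScale_sq_mul z, bottScale_pos z, norm_nonneg z]

theorem norm_bottRotation_le_one (z : ℂ) (j k : Fin 2) : ‖bottRotation z j k‖ ≤ 1 := by
  have h1 := bottScale_le_one z
  have h2 := norm_mul_bottScale_le_one z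
  have h3 := (bottScale_pos z).le
  fin_cases j <;> fin_cases k <;>
    simpa [bottRotation, abs_of_nonneg h3, Complex.norm_exp_ofReal_mul_I]

theorem norm_bott_le_one (z : ℂ) (j k : Fin 2) : ‖bott z j k‖ ≤ 1 := by
  have h1 := bottScale_le_one z
  have h2 := norm_mul_bottScale_le_one z
  have h3 := (bottScale_pos z).le
  have h4 : bottScale z ^ 2 ≤ 1 := pow_le_one₀ h3 h1
  have h5 : ‖z‖ * bottScale z ^ 2 ≤ 1 := by nlinarith [norm_nonneg z]
  have h6 : ‖(1 : ℂ) - (bottScale z : ℂ) ^ 2‖ ≤ 1 := by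
    rw [show (1 : ℂ) - (bottScale z : ℂ) ^ 2 = ((1 - bottScale z ^ 2 : ℝ) : ℂ) by push_cast; rfl,
      Complex.norm_real, Real.norm_of_nonneg (by linarith)]
    nlinarith
  rw [bott_eq]
  fin_cases j <;> fin_cases k <;> simp [abs_of_nonneg h3] <;> assumption

theorem tendsto_bott_sub_diagonal {ι : Type*} {l : Filter ι} {z : ι → ℂ}
    (hz : Tendsto (fun i => bottScale (z i)) l (𝓝 0)) (j k : Fin 2) :
    Tendsto (fun i => bott (z i) j k - Matrix.diagonal ![0, 1] j k) l (𝓝 0) := by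
  refine squeeze_zero_norm (fun i => ?_) hz
  have h1 := bottScale_le_one (z i)
  have h2 := norm_mul_bottScale_le_one (z i)
  have h3 := (bottScale_pos (z i)).le
  have h4 : bottScale (z i) ^ 2 ≤ bottScale (z i) := by nlinarith
  have h5 : ‖z i‖ * bottScale (z i) ^ 2 ≤ bottScale (z i) := by nlinarith
  rw [bott_eq]
  fin_cases j <;> fin_cases k <;> simp [abs_of_nonneg h3] <;> assumption

theorem tendsto_bottRotation_sub_diagonal {ι : Type*} {l : Filter ι} {z : ι → ℂ}
    (hz : Tendsto (fun i => bottScale (z i)) l (𝓝 0)) (j k : Fin 2) :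
    Tendsto (fun i => bottRotation (z i) j k - Matrix.diagonal ![1, 1] j k) l (𝓝 0) := by
  refine squeeze_zero_norm (fun i => ?_) hz
  have h1 := bottScale_le_one (z i)
  have h2 := norm_mul_bottScale_le_one (z i)
  have h3 := bottScale_pos (z i)
  -- With `s` the scale and `t = |z| s ≤ 1`: `1 - t ≤ 1 - t² = s² ≤ s`.
  have h6 : ‖(‖z i‖ : ℂ) * bottScale (z i) - 1‖ ≤ bottScale (z i) := by
    rw [show (‖z i‖ : ℂ) * bottScale (z i) - 1 = ((‖z i‖ * bottScale (z i) - 1 : ℝ) : ℂ) by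
      push_cast; rfl, Complex.norm_real, Real.norm_of_nonpos (by linarith)]
    nlinarith [bottScale_sq_mul (z i), mul_nonneg (norm_nonneg (z i)) h3.le]
  fin_cases j <;> fin_cases k <;>
    simp [bottRotation, abs_of_pos h3, Complex.norm_exp_ofReal_mul_I] <;> assumption

end Bott

/-! ### Identification of `Q` and the main theorem -/

section Main

variable {H : Type*} [NormedAddCommGroup H] [InnerProductSpace ℂ H] {ι : Type*}

theorem IsBlockDiagonal.eventually_corner {f : HilbertBasis ι ℂ H} {z : ι → ℂ}
    {Q : WithLp 2 (H × H) →L[ℂ] WithLp 2 (H × H)} (hQ : IsBlockDiagonal f (fun i => bott (z i)) Q)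
    (hz : Tendsto (fun i => bottScale (z i)) cofinite (𝓝 0)) {κ : Type*} (e : HilbertBasis κ ℂ H) :
    ∀ᶠ F : Finset κ in atTop, ‖corner e F Q * corner e F Q - corner e F Q‖ < 1 / 4 ∧
      (countAboveHalf (corner e F Q) : ℤ) - (F.card : ℤ) = 0 := by
  have hQs : (Q : WithLp 2 (H × H) →ₗ[ℂ] WithLp 2 (H × H)).IsSymmetric := fun v w =>
    hQ.inner_apply (by simpa only [conjTranspose_bott] using hQ) v w
  have hQ2 : ∀ v, Q (Q v) = Q v := by
    have h := hQ.comp hQ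
    simp only [bott_mul_bott] at h
    exact h.unique hQ
  obtain ⟨U, hU⟩ := exists_isBlockDiagonal f (m := fun i => bottRotation (z i)) (C := 1)
    fun i => norm_bottRotation_le_one (z i)
  have hUn : ∀ v, ‖U v‖ = ‖v‖ := hU.norm_apply (fun i => conjTranspose_bottRotation_mul (z i))
    fun i => norm_bottRotation_le_one (z i)
  have hQU := hQ.comp hU
  -- Coordinatewise form of `Q U = U (0 ⊕ 1)`: the first component of `v` is annihilated.
  have hQU' : ∀ v i,
      f.repr (Q (U v)).fst i = bottRotation (z i) 0 1 * f.repr v.snd i ∧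
      f.repr (Q (U v)).snd i = bottRotation (z i) 1 1 * f.repr v.snd i := by
    intro v i
    have h := hQU v i
    simp only [bott_mul_bottRotation] at h
    simpa [Matrix.mul_diagonal] using h
  have e1 := hQ.eventually_approx (fun i => norm_bott_le_one (z i))
    (tendsto_bott_sub_diagonal hz) e (ε := 1 / 8) (by norm_num)
  have e2 := hU.eventually_approx (fun i => norm_bottRotation_le_one (z i))
    (tendsto_bottRotation_sub_diagonal hz) e (ε := 1 / 8) (by norm_num)
  filter_upwards [e1, e2] with F h1 h2
  refine ⟨(norm_compression_sq_sub_le hQs hQ2 (by norm_num) h1).trans_lt (by norm_num), ?_⟩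
  have h3 : countAboveHalf (compression (doubleSpan e F) Q) = F.card :=
    countAboveHalf_compression hQs hQ2 hUn (finrank_doubleSpan e F)
      (M₀ := spanLeft e F) (M₁ := spanRight e F) (fun v hv => ?_) (fun v hv => ?_)
      (finrank_spanLeft e F) (finrank_spanRight e F) (fun v hv => ?_) (fun v hv => ?_) h2
  · rw [sub_eq_zero]
    exact_mod_cast h3
  · rw [mem_spanLeft_iff] at hv
    exact mem_doubleSpan_iff.2 ⟨hv.1, hv.2 ▸ Submodule.zero_mem _⟩
  · rw [mem_spanRight_iff] at hv
    exact mem_doubleSpan_iff.2 ⟨hv.1 ▸ Submodule.zero_mem _, hv.2⟩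
  · rw [mem_spanLeft_iff] at hv
    refine f.ext_repr_prod (fun i => ?_) fun i => ?_
    · rw [(hQU' v i).1, hv.2]
      simp
    · rw [(hQU' v i).2, hv.2]
      simp
  · rw [mem_spanRight_iff] at hv
    refine f.ext_repr_prod (fun i => ?_) fun i => ?_
    · rw [(hQU' v i).1, (hU v i).1, hv.1]
      simp
    · rw [(hQU' v i).2, (hU v i).2, hv.1]
      simp

theorem mem_graph_opC_of_opPlus {A B : H →ₗ.[ℂ] H} {x y : H} (h : (x, y) ∈ (opPlus A B).graph) :
    (x, y) ∈ (opC A B).graph :=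
  LinearPMap.le_graph_of_le (LinearPMap.le_closure _) h

/-- The closure of a non-closable operator is by convention the operator itself, so closability need
not be proved. -/
theorem mem_closure_graph_opPlus {A B : H →ₗ.[ℂ] H} {p : H × H} (h : p ∈ (opC A B).graph) :
    p ∈ closure ((opPlus A B).graph : Set (H × H)) := by
  by_cases hc : (opPlus A B).IsClosable
  · rw [opC, ← hc.graph_closure_eq_closure_graph] at h
    exact h
  · rw [opC, LinearPMap.closure_def' hc] at h
    exact subset_closure h

/-- The point `a i + I * b i` of the joint spectrum. -/
noncomputable def jointPoint (a b : ι → ℝ) (i : ι) : ℂ := a i + b i * Complex.I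

theorem mem_graph_opC_basis {A B : H →ₗ.[ℂ] H}
    {f : HilbertBasis ι ℂ H} {a b : ι → ℝ} (hf : ∀ i, f i ∈ jointEigenspace A B (a i, b i))
    (i : ι) :
    (f i, jointPoint a b i • f i) ∈ (opC A B).graph := by
  refine mem_graph_opC_of_opPlus (mem_graph_opPlus_iff.2 ⟨_, _, (hf i).1, (hf i).2, ?_⟩)
  rw [smul_smul, ← add_smul, jointPoint, mul_comm Complex.I]

theorem dense_domain_opC {A B : H →ₗ.[ℂ] H}
    {f : HilbertBasis ι ℂ H} {a b : ι → ℝ} (hf : ∀ i, f i ∈ jointEigenspace A B (a i, b i)) :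
    Dense ((opC A B).domain : Set H) := by
  have h1 : Submodule.span ℂ (Set.range f) ≤ (opC A B).domain := by
    rw [Submodule.span_le]
    rintro _ ⟨i, rfl⟩
    exact LinearPMap.mem_domain_of_mem_graph (mem_graph_opC_basis hf i)
  exact (Submodule.dense_iff_topologicalClosure_eq_top.2 f.dense_span).mono h1

theorem bottScale_jointPoint_sq (a b : ι → ℝ) (i : ι) :
    bottScale (jointPoint a b i) ^ 2 = (1 + a i ^ 2 + b i ^ 2)⁻¹ := by
  rw [bottScale_sq, Complex.sq_norm, jointPoint, Complex.normSq_add_mul_I, add_assoc]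

theorem bottScale_jointPoint_sq' (a b : ι → ℝ) (i : ι) :
    (bottScale (jointPoint a b i) : ℂ) ^ 2 = (1 + (a i : ℂ) ^ 2 + (b i : ℂ) ^ 2)⁻¹ := by
  exact_mod_cast congrArg ((↑) : ℝ → ℂ) (bottScale_jointPoint_sq a b i)

theorem IsBlockDiagonal.apply_basis {f : HilbertBasis ι ℂ H} {m : ι → Matrix (Fin 2) (Fin 2) ℂ}
    {T : WithLp 2 (H × H) →L[ℂ] WithLp 2 (H × H)} (h : IsBlockDiagonal f m T) (i : ι) (c d : ℂ) :
    T (WithLp.toLp 2 (c • f i, d • f i)) =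
      WithLp.toLp 2 ((m i).mulVec ![c, d] 0 • f i, (m i).mulVec ![c, d] 1 • f i) := by
  classical
  refine f.ext_repr_prod (fun j => ?_) fun j => ?_
  · rw [(h _ j).1]
    simp only [WithLp.toLp_fst, WithLp.toLp_snd, map_smul, lp.coeFn_smul, Pi.smul_apply,
      f.repr_self_apply, smul_eq_mul,
      Matrix.mulVec, dotProduct, Fin.sum_univ_two, Matrix.cons_val_zero, Matrix.cons_val_one]
    split_ifs with hj
    · subst hj; ring
    · ring
  · rw [(h _ j).2]
    simp only [WithLp.toLp_fst, WithLp.toLp_snd, map_smul, lp.coeFn_smul, Pi.smul_apply,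
      f.repr_self_apply, smul_eq_mul,
      Matrix.mulVec, dotProduct, Fin.sum_univ_two, Matrix.cons_val_zero, Matrix.cons_val_one]
    split_ifs with hj
    · subst hj; ring
    · ring

variable [CompleteSpace H]

/-- The relation is a closed condition on the pair `(x, y)` and holds on the graph of `A + iB` by
symmetry of `A` and `B`, so it survives the closure. -/
theorem repr_of_mem_graph_opC {A B : H →ₗ.[ℂ] H} (hA : IsSelfAdjoint A) (hB : IsSelfAdjoint B)
    {f : HilbertBasis ι ℂ H} {a b : ι → ℝ} (hf : ∀ i, f i ∈ jointEigenspace A B (a i, b i))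
    {x y : H} (h : (x, y) ∈ (opC A B).graph) (i : ι) :
    f.repr y i = jointPoint a b i * f.repr x i := by
  have hcl : IsClosed {p : H × H | inner ℂ (f i) p.2 = jointPoint a b i * inner ℂ (f i) p.1} :=
    isClosed_eq (by fun_prop) (by fun_prop)
  have hsub : ((opPlus A B).graph : Set (H × H)) ⊆
      {p : H × H | inner ℂ (f i) p.2 = jointPoint a b i * inner ℂ (f i) p.1} := by
    rintro ⟨u, v⟩ huv
    obtain ⟨s, t, hs, ht, rfl⟩ := mem_graph_opPlus_iff.1 huv
    have h1 := LinearPMap.inner_graph_of_isSelfAdjoint hA (hf i).1 hs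
    have h2 := LinearPMap.inner_graph_of_isSelfAdjoint hB (hf i).2 ht
    rw [inner_smul_left, Complex.conj_ofReal] at h1 h2
    change inner ℂ (f i) (s + Complex.I • t) = jointPoint a b i * inner ℂ (f i) u
    rw [inner_add_right, inner_smul_right, ← h1, ← h2, jointPoint]
    ring
  rw [f.repr_apply_apply, f.repr_apply_apply]
  exact closure_minimal hsub hcl (mem_closure_graph_opPlus h)

theorem repr_apply_of_isBoundedInverse {A B : H →ₗ.[ℂ] H} (hA : IsSelfAdjoint A)
    (hB : IsSelfAdjoint B) {R : H →L[ℂ] H} (hR : IsBoundedInverse (opDelta A B) R)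
    {f : HilbertBasis ι ℂ H} {a b : ι → ℝ} (hf : ∀ i, f i ∈ jointEigenspace A B (a i, b i))
    (x : H) (i : ι) : f.repr (R x) i = (bottScale (jointPoint a b i) : ℂ) ^ 2 * f.repr x i := by
  have h : inner ℂ (R (f i)) x = inner ℂ (f i) (R x) :=
    isSymmetric_of_isBoundedInverse_opDelta hA hB hR (f i) x
  rw [apply_of_mem_jointEigenspace hR (hf i), ← bottScale_jointPoint_sq' a b i, inner_smul_left,
    map_pow, Complex.conj_ofReal] at h
  rw [f.repr_apply_apply, f.repr_apply_apply, h]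

theorem isQ_of_isBlockDiagonal {A B : H →ₗ.[ℂ] H} (hA : IsSelfAdjoint A)
    (hB : IsSelfAdjoint B) {R : H →L[ℂ] H} (hR : IsBoundedInverse (opDelta A B) R)
    {f : HilbertBasis ι ℂ H} {a b : ι → ℝ} (hf : ∀ i, f i ∈ jointEigenspace A B (a i, b i))
    {Q : WithLp 2 (H × H) →L[ℂ] WithLp 2 (H × H)}
    (hQ : IsBlockDiagonal f (fun i => bott (jointPoint a b i)) Q) : IsQ A B Q := by
  have hC : ∀ y, R y ∈ (opC A B).domain := by
    intro y
    obtain ⟨u, v, hu, -, -⟩ := mem_graph_opDelta_iff.1 (hR.mem_graph y)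
    obtain ⟨s, t, hs, ht, -⟩ := mem_graph_opMinus_iff.1 hu
    exact LinearPMap.mem_domain_of_mem_graph
      (mem_graph_opC_of_opPlus (mem_graph_opPlus_iff.2 ⟨s, t, hs, ht, rfl⟩))
  refine ⟨R, hR, hC, fun x y => ?_⟩
  have hCR : ∀ i, f.repr (opC A B ⟨R y, hC y⟩) i = jointPoint a b i *
      ((bottScale (jointPoint a b i) : ℂ) ^ 2 * f.repr y i) := fun i => by
    rw [repr_of_mem_graph_opC hA hB hf ((opC A B).mem_graph ⟨R y, hC y⟩) i,
      repr_apply_of_isBoundedInverse hA hB hR hf]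
  have hCx : ∀ i, f.repr ((opC A B).adjoint x) i =
      (starRingEnd ℂ) (jointPoint a b i) * f.repr (x : H) i := fun i => by
    have h1 := LinearPMap.adjoint_isFormalAdjoint (dense_domain_opC hf) x
    obtain ⟨u, hu, hu'⟩ := (LinearPMap.mem_graph_iff _).1 (mem_graph_opC_basis hf i)
    have h2 := h1 u
    rw [hu, hu', inner_smul_right] at h2
    rw [f.repr_apply_apply, f.repr_apply_apply, ← inner_conj_symm, h2, map_mul, inner_conj_symm]
  refine f.ext_repr_prod (fun i => ?_) fun i => ?_
  · rw [(hQ _ i).1]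
    simp only [WithLp.toLp_fst, WithLp.toLp_snd, map_add, lp.coeFn_add, Pi.add_apply, hCR,
      repr_apply_of_isBoundedInverse hA hB hR hf, bott_eq]
    simp
    ring
  · rw [(hQ _ i).2]
    simp only [WithLp.toLp_fst, WithLp.toLp_snd, map_add, map_sub, lp.coeFn_add, lp.coeFn_sub,
      Pi.add_apply, Pi.sub_apply, hCx,
      repr_apply_of_isBoundedInverse hA hB hR hf, bott_eq]
    simp
    ring

theorem IsQ.apply_eq {A B : H →ₗ.[ℂ] H} {Q Q' : WithLp 2 (H × H) →L[ℂ] WithLp 2 (H × H)}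
    (h : IsQ A B Q) (h' : IsQ A B Q') {x : H} (hx : x ∈ (opC A B).adjoint.domain) (y : H) :
    Q (WithLp.toLp 2 (x, y)) = Q' (WithLp.toLp 2 (x, y)) := by
  obtain ⟨R, hR, hC, hQ⟩ := h
  obtain ⟨R', hR', hC', hQ'⟩ := h'
  obtain rfl := hR.unique hR'
  rw [hQ ⟨x, hx⟩ y, hQ' ⟨x, hx⟩ y]

/-- `IsQ` fixes `Q` only on `D(C*) ⊕ H`; this puts the basis vectors in that domain, so that any `Q`
with `IsQ` has the computed blocks. -/
theorem mem_adjoint_domain_opC {A B : H →ₗ.[ℂ] H} (hA : IsSelfAdjoint A) (hB : IsSelfAdjoint B)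
    {f : HilbertBasis ι ℂ H} {a b : ι → ℝ} (hf : ∀ i, f i ∈ jointEigenspace A B (a i, b i))
    (i : ι) : f i ∈ (opC A B).adjoint.domain := by
  refine LinearPMap.mem_adjoint_domain_of_exists _
    ⟨(starRingEnd ℂ) (jointPoint a b i) • f i, fun x => ?_⟩
  have h := repr_of_mem_graph_opC hA hB hf ((opC A B).mem_graph x) i
  rw [f.repr_apply_apply, f.repr_apply_apply] at h
  rw [h, inner_smul_left, Complex.conj_conj]

end Main

theorem mainTheorem4 {H : Type*} [NormedAddCommGroup H] [InnerProductSpace ℂ H] [CompleteSpace H]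
    [TopologicalSpace.SeparableSpace H] (A B : H →ₗ.[ℂ] H)
    (hA : IsSelfAdjoint A) (hB : IsSelfAdjoint B) (hAB : StronglyCommute A B)
    (hΔ : ∃ R : H →L[ℂ] H, IsBoundedInverse (opDelta A B) R ∧ IsCompactOperator R) :
    HasOmega A B 0 ∧
    ∃ (ι : Type) (f : HilbertBasis ι ℂ H) (a b : ι → ℝ),
      IsMultiplication f a A ∧ IsMultiplication f b B ∧
      Tendsto (fun i => a i ^ 2 + b i ^ 2) cofinite atTop ∧
      ∀ Q : WithLp 2 (H × H) →L[ℂ] WithLp 2 (H × H), IsQ A B Q → ∀ i : ι,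
        IsStarProjection (bott (a i + b i * Complex.I)) ∧
        (bott (a i + b i * Complex.I)).rank = 1 ∧
        ∀ c d : ℂ, Q (WithLp.toLp 2 (c • f i, d • f i)) =
          WithLp.toLp 2
            ((bott (a i + b i * Complex.I)).mulVec ![c, d] 0 • f i,
              (bott (a i + b i * Complex.I)).mulVec ![c, d] 1 • f i) := by
  obtain ⟨R, hR, hRc⟩ := hΔ
  obtain ⟨ι, f, a, b, hf⟩ := exists_hilbertBasis_jointEigenvector hA hB hAB hR hRc
  have hr : Tendsto (fun i => (1 + a i ^ 2 + b i ^ 2)⁻¹) cofinite (𝓝 0) :=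
    f.orthonormal.tendsto_cofinite_of_isCompactOperator hRc fun i => by
      rw [apply_of_mem_jointEigenspace hR (hf i)]
      push_cast
      rfl
  have hab : Tendsto (fun i => a i ^ 2 + b i ^ 2) cofinite atTop := by
    have h1 : Tendsto (fun i => (1 + a i ^ 2 + b i ^ 2)⁻¹) cofinite (𝓝[>] 0) :=
      tendsto_nhdsWithin_iff.2 ⟨hr, Eventually.of_forall fun i => by
        rw [Set.mem_Ioi]; positivity⟩
    -- The eigenvalues of `R` tend to `0` through positive numbers, so their reciprocals `1 + a² +
    -- b²` tend to infinity; the `-1` removes the constant.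
    have h2 := tendsto_atTop_add_const_right _ (-1) h1.inv_tendsto_nhdsGT_zero
    refine h2.congr fun i => ?_
    rw [Pi.inv_apply, inv_inv]
    ring
  have hz : Tendsto (fun i => bottScale (jointPoint a b i)) cofinite (𝓝 0) := by
    have h1 := (Real.continuous_sqrt.tendsto 0).comp hr
    rw [Real.sqrt_zero] at h1
    refine h1.congr fun i => ?_
    rw [Function.comp_apply, ← bottScale_jointPoint_sq, Real.sqrt_sq (bottScale_pos _).le]
  obtain ⟨T, hT⟩ := exists_isBlockDiagonal f (m := fun i => bott (jointPoint a b i)) (C := 1)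
    fun i => norm_bott_le_one _
  have hTQ := isQ_of_isBlockDiagonal hA hB hR hf hT
  refine ⟨⟨⟨R, hR, hRc⟩, T, hTQ, ?_, fun κ e => hT.eventually_corner hz e⟩, ι, f, a, b,
    isMultiplication_of_mem_realEigenspace hA f fun i => (hf i).1,
    isMultiplication_of_mem_realEigenspace hB f fun i => (hf i).2, hab, fun Q hQ i =>
      ⟨⟨bott_mul_bott _, conjTranspose_bott _⟩, rank_bott _, fun c d => ?_⟩⟩
  · have h := hT.comp hT
    simp only [bott_mul_bott] at h
    have h2 : T * T = T := ContinuousLinearMap.ext (h.unique hT)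
    rw [h2, sub_self, norm_zero]
    norm_num
  · rw [hQ.apply_eq hTQ (Submodule.smul_mem _ c (mem_adjoint_domain_opC hA hB hf i))]
    exact hT.apply_basis i c d
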